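/- All Hilbert spaces are finite-dimensional and logarithms are to base $2$. Let $\hat\rho_{AB}=\{\rho^n_{AB}\}_{n\ge 1}$ be an arbitrary sequence of bipartite states, $\rho^n_{AB}$ a density operator on $\mathscr H_A^{\otimes n}\otimes\mathscr H_B^{\otimes n}$. A (CP) instrument on a system $A$ is a finite family $\{\mathcal E_x:A\to A'\}_{x\in\mathcal X}$ of completely positive maps whose sum is trace-preserving. A one-way LOCC map is a map $\sum_{x}\mathcal E_x\otimes\mathcal D_x$ with $\{\mathcal E_x\}$ an instrument on Alice's side and every $\mathcal D_x$ a CPTP map on Bob's side. A two-way LOCC map is a map implemented by finitely many rounds, in each of which Alice or Bob applies an instrument, which may depend on all outcomes announced so far, and announces its outcome. For $\varepsilon\ge0$, a real $R\ge0$ is an $\varepsilon$-achievable one-way (two-way) rate for a bipartite state $\rho$ if there are an integer $M\ge 2^R$, a maximally entangled state $\Psi_M$ of rank $M$ of some systems $A'B'$, i.e. a pure state with vector $M^{-1/2}\sum_{i=1}^M|e_i\rangle\otimes|f_i\rangle$ for orthonormal families $(e_i)$, $(f_i)$, and a one-way (two-way) LOCC map $\Lambda:AB\to A'B'$ with $F(\Lambda(\rho),\Psi_M)\ge1-\varepsilon$,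 where $F(\rho,\sigma)=\operatorname{Tr}\sqrt{\sqrt\rho\,\sigma\sqrt\rho}$. Let $E_D^{\rightarrow}(\rho;\varepsilon)$ and $E_D^{\leftrightarrow}(\rho;\varepsilon)$ be the supremum of these rates, and put $$E_{D,\infty}^{\rightarrow}(\hat\rho_{AB})=\lim_{\varepsilon\downarrow0}\liminf_{n\to\infty}\frac1nE_D^{\rightarrow}(\rho^n_{AB};\varepsilon),\qquad E_{D,\infty}^{\leftrightarrow}(\hat\rho_{AB})=\lim_{\varepsilon\downarrow0}\liminf_{n\to\infty}\frac1nE_D^{\leftrightarrow}(\rho^n_{AB};\varepsilon).$$ For a sequence of states $\hat\omega=\{\omega_n\}$ and a sequence of positive operators $\hat\tau=\{\tau_n\}$ put $$\underline D(\hat\omega\|\hat\tau)=\sup\Bigl\{\gamma\in\mathbb R:\liminf_{n\to\infty}\operatorname{Tr}\bigl[\{\Pi_n(\gamma)\ge0\}\,\Pi_n(\gamma)\bigr]=1\Bigr\},\qquad \Pi_n(\gamma)=\omega_n-2^{n\gamma}\tau_n$$ (an extended real number), where $\{X\ge0\}$ is the projector onto the subspace where the Hermitian operator $X$ is non-negative.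 For a sequence $\hat\omega_{A'B'}$ of bipartite states on $A'_nB'_n$ put $\underline I^{A'\to B'}(\hat\omega_{A'B'})=\inf_{\hat\tau_{B'}}\underline D(\hat\omega_{A'B'}\|\hat{\mathbb 1}_{A'}\otimes\hat\tau_{B'})$, the infimum being over all sequences of states $\tau_n$ on $B'_n$. Then $$E_{D,\infty}^{\rightarrow}(\hat\rho_{AB})=\max_{\hat{\mathscr I}_A}\underline I^{A'\to B\mathcal X}(\hat\sigma_{A'B\mathcal X}),\qquad E_{D,\infty}^{\leftrightarrow}(\hat\rho_{AB})=\max_{\hat\Lambda}\underline I^{A'\to B'}(\hat\nu_{A'B'}).$$ The first maximum is over all sequences of instruments $\mathscr I_A^n=\{\mathcal E^n_x\}_{x\in\mathcal X_n}$ from $\mathscr H_A^{\otimes n}$ to arbitrary $A'_n$, with $\sigma^n_{A'B\mathcal X}=\sum_{x\in\mathcal X_n}(\mathcal E^n_x\otimes\mathrm{id})(\rho^n_{AB})\otimes|x\rangle\langle x|$ and the classical register $\mathcal X_n$ held together with $B$. The second is over all sequences of two-way LOCC maps $\Lambda^n$ from $\mathscr H_A^{\otimes n}\otimes\mathscr H_B^{\otimes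 n}$ to arbitrary $A'_nB'_n$, with $\nu^n_{A'B'}=\Lambda^n(\rho^n_{AB})$. Both maxima are attained. -/

import Mathlib

open Filter Topology
open scoped Kronecker ComplexOrder

noncomputable section

namespace Distill

/-- Linear operators on the finite-dimensional Hilbert space with orthonormal basis indexed by `a`. -/
abbrev Op (a : Type) : Type := Matrix a a ℂ

/-- Density operators: positive operators of unit trace. -/
def IsState {a : Type} [Fintype a] (ρ : Op a) : Prop :=
  ρ.PosSemidef ∧ ρ.trace = 1

/-! ### Completely positive maps, instruments, LOCC -/

/-- The map `id_c ⊗ Φ`, acting blockwise. -/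
def onRight (c : Type) {a a' : Type} (Φ : Op a →ₗ[ℂ] Op a') : Op (c × a) →ₗ[ℂ] Op (c × a') where
  toFun X := Matrix.of fun p q => Φ (Matrix.of fun i j => X (p.1, i) (q.1, j)) p.2 q.2
  map_add' X Y := by
    ext p q
    exact congrFun (congrFun (Φ.map_add (Matrix.of fun i j => X (p.1, i) (q.1, j))
      (Matrix.of fun i j => Y (p.1, i) (q.1, j))) p.2) q.2
  map_smul' z X := by
    ext p q
    exact congrFun (congrFun (Φ.map_smul z (Matrix.of fun i j => X (p.1, i) (q.1, j))) p.2) q.2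

/-- The map `Φ ⊗ id_c`, acting blockwise. -/
def onLeft (c : Type) {a a' : Type} (Φ : Op a →ₗ[ℂ] Op a') : Op (a × c) →ₗ[ℂ] Op (a' × c) where
  toFun X := Matrix.of fun p q => Φ (Matrix.of fun i j => X (i, p.2) (j, q.2)) p.1 q.1
  map_add' X Y := by
    ext p q
    exact congrFun (congrFun (Φ.map_add (Matrix.of fun i j => X (i, p.2) (j, q.2))
      (Matrix.of fun i j => Y (i, p.2) (j, q.2))) p.1) q.1
  map_smul' z X := by
    ext p q
    exact congrFun (congrFun (Φ.map_smul z (Matrix.of fun i j => X (i, p.2) (j, q.2))) p.1) q.1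

/-- Complete positivity: every amplification `id_k ⊗ Φ` preserves positive semidefiniteness. -/
def IsCP {a a' : Type} (Φ : Op a →ₗ[ℂ] Op a') : Prop :=
  ∀ (k : ℕ) (X : Op (Fin k × a)), X.PosSemidef → (onRight (Fin k) Φ X).PosSemidef

/-- Trace preservation. -/
def IsTP {a a' : Type} [Fintype a] [Fintype a'] (Φ : Op a →ₗ[ℂ] Op a') : Prop :=
  ∀ X : Op a, (Φ X).trace = X.trace

/-- A family of CP maps with a trace-preserving sum. -/
def IsInstrument {a a' : Type} [Fintype a] [Fintype a'] {k : ℕ}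
    (E : Fin k → (Op a →ₗ[ℂ] Op a')) : Prop :=
  (∀ x, IsCP (E x)) ∧ IsTP (∑ x, E x)

/-- An instrument on the system `a`, with its quantum output of dimension `dim`
and its finite classical register of size `card`. -/
structure Instrument (a : Type) [Fintype a] where
  dim : ℕ
  card : ℕ
  map : Fin card → (Op a →ₗ[ℂ] Op (Fin dim))
  isInstrument : IsInstrument map

/-- `∑ x, (E x ⊗ id_b)(ρ) ⊗ |x⟩⟨x|`; the classical register is held together with `b`. -/
def Instrument.output {a b : Type} [Fintype a] (I : Instrument a) (ρ : Op (a × b)) :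
    Op (Fin I.dim × (b × Fin I.card)) :=
  Matrix.of fun p q =>
    if p.2.2 = q.2.2 then onLeft b (I.map p.2.2) ρ (p.1, p.2.1) (q.1, q.2.1) else 0

/-- One-way (forward) LOCC maps `∑ x, E x ⊗ D x`: Alice applies an instrument and communicates
the outcome to Bob, who applies a CPTP map depending on it. -/
def IsOneWayLOCC {a b a' b' : Type} [Fintype a] [Fintype b] [Fintype a'] [Fintype b']
    (Λ : Op (a × b) →ₗ[ℂ] Op (a' × b')) : Prop :=
  ∃ (k : ℕ) (E : Fin k → (Op a →ₗ[ℂ] Op a')) (D : Fin k → (Op b →ₗ[ℂ] Op b')),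
    IsInstrument E ∧ (∀ x, IsCP (D x) ∧ IsTP (D x)) ∧
      Λ = ∑ x, onRight a' (D x) ∘ₗ onLeft b (E x)

/-- Two-way LOCC maps with final systems `a'`, `b'`: finitely many rounds, in each of which one
of the parties applies an instrument and announces the outcome; everything that follows may
depend on the outcomes announced so far. -/
inductive IsTwoWayLOCC {a' b' : Type} :
    ∀ {a b : Type}, (Op (a × b) →ₗ[ℂ] Op (a' × b')) → Prop
  | done : IsTwoWayLOCC (LinearMap.id : Op (a' × b') →ₗ[ℂ] Op (a' × b'))
  | alice {a b : Type} [Fintype a] {d k : ℕ} (E : Fin k → (Op a →ₗ[ℂ] Op (Fin d)))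
      (hE : IsInstrument E) (Λ : Fin k → (Op (Fin d × b) →ₗ[ℂ] Op (a' × b')))
      (hΛ : ∀ x, IsTwoWayLOCC (Λ x)) :
      IsTwoWayLOCC (∑ x, Λ x ∘ₗ onLeft b (E x))
  | bob {a b : Type} [Fintype b] {d k : ℕ} (E : Fin k → (Op b →ₗ[ℂ] Op (Fin d)))
      (hE : IsInstrument E) (Λ : Fin k → (Op (a × Fin d) →ₗ[ℂ] Op (a' × b')))
      (hΛ : ∀ x, IsTwoWayLOCC (Λ x)) :
      IsTwoWayLOCC (∑ x, Λ x ∘ₗ onRight a (E x))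

/-- A two-way LOCC operation on `a`, `b`, with its output systems of dimensions `dimA`, `dimB`. -/
structure TwoWayLOCC (a b : Type) where
  dimA : ℕ
  dimB : ℕ
  map : Op (a × b) →ₗ[ℂ] Op (Fin dimA × Fin dimB)
  isTwoWayLOCC : IsTwoWayLOCC map

/-! ### One-shot distillable entanglement -/

/-- `Ψ` is (the projector onto) a maximally entangled state of rank `M`:
`M ^ (-1/2) * ∑ i, e i ⊗ f i` for orthonormal families `e`, `f`. -/
def IsMES {a b : Type} [Fintype a] [Fintype b] (M : ℕ) (Ψ : Op (a × b)) : Prop :=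
  ∃ (e : Fin M → EuclideanSpace ℂ a) (f : Fin M → EuclideanSpace ℂ b),
    Orthonormal ℂ e ∧ Orthonormal ℂ f ∧
      let ψ : a × b → ℂ := fun p => ((√(M : ℝ))⁻¹ : ℝ) * ∑ i, e i p.1 * f i p.2
      Ψ = Matrix.vecMulVec ψ (star ψ)

/-- The fidelity `Tr √(√ρ σ √ρ)`. -/
def fidelity {a : Type} [Fintype a] [DecidableEq a] (ρ σ : Op a) : ℝ :=
  (cfc Real.sqrt (cfc Real.sqrt ρ * σ * cfc Real.sqrt ρ)).trace.re

/-- `R` is an `ε`-achievable rate for one-way distillation from `ρ`. -/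
def OneWayAchievable {a b : Type} [Fintype a] [Fintype b] (ρ : Op (a × b)) (ε R : ℝ) : Prop :=
  0 ≤ R ∧ ∃ (M dA dB : ℕ) (Ψ : Op (Fin dA × Fin dB))
    (Λ : Op (a × b) →ₗ[ℂ] Op (Fin dA × Fin dB)),
    (2 : ℝ) ^ R ≤ M ∧ IsMES M Ψ ∧ IsOneWayLOCC Λ ∧ 1 - ε ≤ fidelity (Λ ρ) Ψ

/-- `R` is an `ε`-achievable rate for two-way distillation from `ρ`. -/
def TwoWayAchievable {a b : Type} (ρ : Op (a × b)) (ε R : ℝ) : Prop :=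
  0 ≤ R ∧ ∃ (M dA dB : ℕ) (Ψ : Op (Fin dA × Fin dB))
    (Λ : Op (a × b) →ₗ[ℂ] Op (Fin dA × Fin dB)),
    (2 : ℝ) ^ R ≤ M ∧ IsMES M Ψ ∧ IsTwoWayLOCC Λ ∧ 1 - ε ≤ fidelity (Λ ρ) Ψ

/-- One-shot distillable entanglement under one-way LOCC. -/
def oneWayED {a b : Type} [Fintype a] [Fintype b] (ρ : Op (a × b)) (ε : ℝ) : EReal :=
  ⨆ (R : ℝ) (_ : OneWayAchievable ρ ε R), (R : EReal)

/-- One-shot distillable entanglement under two-way LOCC. -/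
def twoWayED {a b : Type} (ρ : Op (a × b)) (ε : ℝ) : EReal :=
  ⨆ (R : ℝ) (_ : TwoWayAchievable ρ ε R), (R : EReal)

/-! ### Asymptotic distillable entanglement -/

/-- Operators on `H_A^{⊗n} ⊗ H_B^{⊗n}`. -/
abbrev OpN (a b : Type) (n : ℕ) : Type := Op ((Fin n → a) × (Fin n → b))

/-- `liminf (1/n) E_D(ρ n; ε)` as `n → ∞`, one-way. -/
def oneWayRate {a b : Type} [Fintype a] [Fintype b] (ρ : ∀ n, OpN a b n) (ε : ℝ) : EReal :=
  liminf (fun n : ℕ => (((n : ℝ)⁻¹ : ℝ) : EReal) * oneWayED (ρ n) ε) atTop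

/-- `liminf (1/n) E_D(ρ n; ε)` as `n → ∞`, two-way. -/
def twoWayRate {a b : Type} (ρ : ∀ n, OpN a b n) (ε : ℝ) : EReal :=
  liminf (fun n : ℕ => (((n : ℝ)⁻¹ : ℝ) : EReal) * twoWayED (ρ n) ε) atTop

/-- One-way distillable entanglement of a sequence: the limit of `oneWayRate ρ ε` as `ε → 0`. -/
def oneWayDistillable {a b : Type} [Fintype a] [Fintype b] (ρ : ∀ n, OpN a b n) : EReal :=
  limUnder (𝓝[>] (0 : ℝ)) (oneWayRate ρ)

/-- Two-way distillable entanglement of a sequence: the limit of `twoWayRate ρ ε` as `ε → 0`. -/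
def twoWayDistillable {a b : Type} (ρ : ∀ n, OpN a b n) : EReal :=
  limUnder (𝓝[>] (0 : ℝ)) (twoWayRate ρ)

theorem oneWayRate_mono {a b : Type} [Fintype a] [Fintype b] (ρ : ∀ n, OpN a b n) :
    Monotone (oneWayRate ρ) := by
  intro ε δ h
  refine liminf_le_liminf (Eventually.of_forall fun n => ?_)
  refine mul_le_mul_of_nonneg_left ?_ (EReal.coe_nonneg.2 (by positivity))
  refine iSup_mono fun R => iSup_mono' fun hR => ⟨?_, le_rfl⟩
  obtain ⟨h0, M, dA, dB, Ψ, Λ, h1, h2, h3, h4⟩ := hR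
  exact ⟨h0, M, dA, dB, Ψ, Λ, h1, h2, h3, by linarith⟩

theorem twoWayRate_mono {a b : Type} (ρ : ∀ n, OpN a b n) : Monotone (twoWayRate ρ) := by
  intro ε δ h
  refine liminf_le_liminf (Eventually.of_forall fun n => ?_)
  refine mul_le_mul_of_nonneg_left ?_ (EReal.coe_nonneg.2 (by positivity))
  refine iSup_mono fun R => iSup_mono' fun hR => ⟨?_, le_rfl⟩
  obtain ⟨h0, M, dA, dB, Ψ, Λ, h1, h2, h3, h4⟩ := hR
  exact ⟨h0, M, dA, dB, Ψ, Λ, h1, h2, h3, by linarith⟩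

/-- The limit defining `oneWayDistillable` exists. -/
theorem tendsto_oneWayRate {a b : Type} [Fintype a] [Fintype b] (ρ : ∀ n, OpN a b n) :
    Tendsto (oneWayRate ρ) (𝓝[>] (0 : ℝ)) (𝓝 (oneWayDistillable ρ)) :=
  tendsto_nhds_limUnder ⟨_, (oneWayRate_mono ρ).tendsto_nhdsGT 0⟩

/-- The limit defining `twoWayDistillable` exists. -/
theorem tendsto_twoWayRate {a b : Type} (ρ : ∀ n, OpN a b n) :
    Tendsto (twoWayRate ρ) (𝓝[>] (0 : ℝ)) (𝓝 (twoWayDistillable ρ)) :=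
  tendsto_nhds_limUnder ⟨_, (twoWayRate_mono ρ).tendsto_nhdsGT 0⟩

/-! ### Spectral rates -/

/-- The projector `{X ≥ 0}` onto the subspace where the Hermitian operator `X` is nonnegative. -/
def nonnegProj {a : Type} [Fintype a] [DecidableEq a] (X : Op a) : Op a :=
  cfc (fun t : ℝ => if 0 ≤ t then (1 : ℝ) else 0) X

/-- The difference operator `ρ n - 2 ^ (n γ) σ n`. -/
def diffOp {α : ℕ → Type} (ρ σ : ∀ n, Op (α n)) (γ : ℝ) (n : ℕ) : Op (α n) :=
  ρ n - ((2 : ℝ) ^ ((n : ℝ) * γ)) • σ n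

/-- The spectral inf-divergence rate
`sup {γ : liminf Tr[{Π_n(γ) ≥ 0} Π_n(γ)] = 1}`, an extended real number. -/
def infDivergenceRate {α : ℕ → Type} [∀ n, Fintype (α n)] [∀ n, DecidableEq (α n)]
    (ρ σ : ∀ n, Op (α n)) : EReal :=
  ⨆ (γ : ℝ) (_ : liminf (fun n : ℕ =>
      (((nonnegProj (diffOp ρ σ γ n) * diffOp ρ σ γ n).trace.re : ℝ) : EReal)) atTop = 1),
    (γ : EReal)

/-- The spectral inf-coherent information rate from `α` to `β`: the infimum of the spectral
inf-divergence rates of `ρ` relative to `1 ⊗ σ`, over all sequences `σ` of states on `β`. -/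
def infCoherentRate {α β : ℕ → Type} [∀ n, Fintype (α n)] [∀ n, DecidableEq (α n)]
    [∀ n, Fintype (β n)] [∀ n, DecidableEq (β n)] (ρ : ∀ n, Op (α n × β n)) : EReal :=
  ⨅ (σ : ∀ n, Op (β n)) (_ : ∀ n, IsState (σ n)),
    infDivergenceRate ρ (fun n => (1 : Op (α n)) ⊗ₖ σ n)

end Distill

end

/-!
A spectral divergence rate is governed by *tests*, that is, operators `0 ≤ P ≤ 1`:
`Tr {X ≥ 0} X` is the maximum of `Re Tr P X` over all tests `P`. Up to the boundary case, a rate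
`γ` lies below the coherent information rate of a sequence `ω n` when, for large `n` and uniformly
in the state `τ`, some test accepts `ω n` with probability near `1` and has weight much less than
`2 ^ (-n γ)` on `1 ⊗ τ` (`eventually_forall_state`, `le_infCoherentRate`). Both halves of each
formula are statements about such tests.

*Achievability.* By Sion's minimax theorem one test `P` works for all `τ` simultaneously, and then
its partial trace over Alice's system is at most `lam = δ 2 ^ (-n γ)`
(`exists_effect_of_forall_state`). From such a `P` about `1 / lam` dimensions of maximal
entanglement are distilled by a random code (`exists_oneWayLOCC_of_effect`): Alice applies the
instrument whose Kraus operators are `c ∑ i, |i⟩⟨z i|`, for all choices of vectors `z i` whose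
components are cube roots of unity, and announces the outcome. With `Q = √P`, the natural decoder is
the partial isometry in the polar decomposition of `W = ∑ i, |i⟩ ⊗ Q (|z i⟩ ⊗ 1)`. Its overlap with
the target is the expectation of `√H` for `H = W Wᴴ`, and `√H ≥ (3 H - H²) / 2`, so that the first
two moments of `H` over the code suffice; they are computed from the second and fourth moments of
the phases (`sum_trace_codeGram`, `sum_trace_codeGram_mul`). The average overlap is at least
`Tr P ω (1 - M lam / 2)`. No purification, decoupling or Haar measure is needed. Running the
protocol after an instrument or after a two-way protocol gives a protocol of the same kind.

*Converse.* If a protocol with output close to a maximally entangled state `Ψ` of rank `M` exists,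
then `Ψ` itself is a good test, because `Tr Ψ (1 ⊗ τ) ≤ 1 / M` for every state `τ`. In the two-way
case it is applied to the output of the protocol, in the one-way case it is pulled back along Bob's
operations to the output of Alice's instrument. A diagonal choice of protocols with errors tending
to `0` yields one sequence whose coherent information rate is at least the distillable
entanglement, so the maxima are attained.
-/

noncomputable section

namespace Distill

open Matrix
open scoped MatrixOrder

/-! ### Positive operators, contractions and the fidelity -/

section Basics

variable {m n : Type} [Fintype m] [Fintype n]

theorem re_trace_mul_nonneg {A B : Op m} (hA : A.PosSemidef) (hB : B.PosSemidef) :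
    0 ≤ (A * B).trace.re := by
  classical
  obtain ⟨C, rfl⟩ := CStarAlgebra.nonneg_iff_eq_star_mul_self.mp hA.nonneg
  have h := (hB.mul_mul_conjTranspose_same C).trace_nonneg
  rw [Matrix.trace_mul_cycle] at h
  exact (Complex.nonneg_iff.1 h).1

theorem re_trace_nonneg {A : Op m} (hA : A.PosSemidef) : 0 ≤ A.trace.re :=
  (Complex.nonneg_iff.1 hA.trace_nonneg).1

theorem re_trace_mul_le {A A' B : Op m} (hA : (A' - A).PosSemidef) (hB : B.PosSemidef) :
    (A * B).trace.re ≤ (A' * B).trace.re := by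
  have h := re_trace_mul_nonneg hA hB
  rw [Matrix.sub_mul, Matrix.trace_sub, Complex.sub_re] at h
  linarith

theorem star_dotProduct_self_eq (v : m → ℂ) : star v ⬝ᵥ v = ((star v ⬝ᵥ v).re : ℂ) := by
  have h : 0 ≤ star v ⬝ᵥ v := dotProduct_star_self_nonneg v
  exact Complex.ext rfl (by simpa using (Complex.nonneg_iff.1 h).2.symm)

/-- The square root of `0 ≤ P ≤ 1`, with the estimate `(1 - √P)² ≤ 1 - P`. -/
theorem exists_sqrt_of_effect [DecidableEq m] {P : Op m} (hP : P.PosSemidef)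
    (hP1 : (1 - P).PosSemidef) :
    ∃ Q : Op m, Q.PosSemidef ∧ Q * Q = P ∧ ((1 - P) - (1 - Q) * (1 - Q)).PosSemidef := by
  have hsa : IsSelfAdjoint P := hP.1
  have hmul : cfc Real.sqrt P * cfc Real.sqrt P = P := by
    rw [← cfc_mul Real.sqrt Real.sqrt P]
    conv_rhs => rw [← cfc_id' ℝ P]
    refine cfc_congr fun x hx => ?_
    exact Real.mul_self_sqrt (spectrum_nonneg_of_nonneg hP.nonneg hx)
  refine ⟨cfc Real.sqrt P, (cfc_nonneg fun x _ => Real.sqrt_nonneg x).posSemidef, hmul, ?_⟩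
  have h1 : (1 - P) - (1 - cfc Real.sqrt P) * (1 - cfc Real.sqrt P)
      = cfc (fun x : ℝ => 2 * (Real.sqrt x - x)) P := by
    rw [cfc_const_mul (2 : ℝ) (fun x => Real.sqrt x - x) P, cfc_sub Real.sqrt (fun x => x) P,
      cfc_id' ℝ P]
    have : (1 - cfc Real.sqrt P) * (1 - cfc Real.sqrt P)
      = 1 - cfc Real.sqrt P - cfc Real.sqrt P + cfc Real.sqrt P * cfc Real.sqrt P := by
        noncomm_ring
    rw [this, hmul, two_smul]
    abel
  rw [h1]
  refine (cfc_nonneg fun x hx => ?_).posSemidef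
  have h0 : 0 ≤ x := spectrum_nonneg_of_nonneg hP.nonneg hx
  have hx1 : x ≤ 1 := by
    have h3 : P ≤ algebraMap ℝ _ 1 := by
      rw [map_one]; exact hP1
    exact (le_algebraMap_iff_spectrum_le).1 h3 x hx
  have := Real.le_sqrt_of_sq_le (by nlinarith : x ^ 2 ≤ x)
  linarith

theorem nonnegProj_posSemidef [DecidableEq m] (X : Op m) : (nonnegProj X).PosSemidef :=
  (cfc_nonneg fun x _ => by positivity).posSemidef

theorem one_sub_nonnegProj_posSemidef [DecidableEq m] (X : Op m) :
    (1 - nonnegProj X).PosSemidef := by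
  have : nonnegProj X ≤ 1 := cfc_le_one _ _ fun x _ => by split_ifs <;> norm_num
  exact this

/-- Variational characterisation of `Tr {X ≥ 0} X`, one direction: it dominates the value at `X` of
each positive functional that is bounded by the trace. -/
theorem re_apply_le_re_trace_nonnegProj_mul [DecidableEq m] {X : Op m} (hX : X.IsHermitian)
    (f : Op m →ₗ[ℂ] ℂ) (hf0 : ∀ Y : Op m, Y.PosSemidef → 0 ≤ (f Y).re)
    (hf1 : ∀ Y : Op m, Y.PosSemidef → (f Y).re ≤ Y.trace.re) :
    (f X).re ≤ (nonnegProj X * X).trace.re := by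
  have hsa : IsSelfAdjoint X := hX
  have hc : ∀ g : ℝ → ℝ, ContinuousOn g (spectrum ℝ X) := fun g =>
    (Matrix.finite_real_spectrum).continuousOn g
  have h1 : nonnegProj X * X
      = cfc (fun t : ℝ => (if 0 ≤ t then (1 : ℝ) else 0) * t) X := by
    rw [cfc_mul _ _ X (hc _) (hc _), cfc_id' ℝ X]
    rfl
  have h2 : (nonnegProj X * X).PosSemidef := by
    rw [h1]
    refine (cfc_nonneg fun x _ => ?_).posSemidef
    split_ifs with h <;> simp [h]
  have h3 : (nonnegProj X * X - X).PosSemidef := by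
    have : nonnegProj X * X - X
        = cfc (fun t : ℝ => (if 0 ≤ t then (1 : ℝ) else 0) * t - t) X := by
      rw [cfc_sub _ _ X (hc _) (hc _), cfc_id' ℝ X, h1]
    rw [this]
    refine (cfc_nonneg fun x _ => ?_).posSemidef
    split_ifs with h
    · simp
    · simp only [not_le] at h
      linarith
  have h4 := hf0 _ h3
  rw [map_sub, Complex.sub_re] at h4
  linarith [hf1 _ h2]

/-- The functional `X ↦ Tr (T X)`. -/
def traceMul (T : Op m) : Op m →ₗ[ℂ] ℂ :=
  Matrix.traceLinearMap m ℂ ℂ ∘ₗ LinearMap.mulLeft ℂ T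

@[simp] theorem traceMul_apply (T X : Op m) : traceMul T X = (T * X).trace := rfl

theorem re_trace_effect_mul_le [DecidableEq m] {T : Op m}
    (hT1 : (1 - T).PosSemidef) {Y : Op m} (hY : Y.PosSemidef) :
    (T * Y).trace.re ≤ Y.trace.re := by
  simpa using re_trace_mul_le hT1 hY

/-- For `H = W Wᴴ` there is a contraction `V`, namely `2 W (1 + Wᴴ W)⁻¹`, with
`V Wᴴ ≥ (3 H - H²) / 2`. It replaces the partial isometry of the polar decomposition of `W`. -/
theorem exists_contraction_mul_ge [DecidableEq m] [DecidableEq n] (W : Matrix m n ℂ) :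
    ∃ V : Matrix m n ℂ, (1 - Vᴴ * V).PosSemidef ∧
      (V * Wᴴ - (2⁻¹ : ℂ) • ((3 : ℂ) • (W * Wᴴ) - (W * Wᴴ) * (W * Wᴴ))).PosSemidef := by
  set H : Op n := Wᴴ * W with hH
  have hHp : H.PosSemidef := Matrix.posSemidef_conjTranspose_mul_self W
  have hpd : (1 + H).PosDef := Matrix.PosDef.one.add_posSemidef hHp
  set R : Op n := (1 + H)⁻¹ with hR
  have hRp : R.PosSemidef := hpd.inv.posSemidef
  have hu : IsUnit (1 + H).det := (Matrix.isUnit_iff_isUnit_det _).1 hpd.isUnit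
  have e1 : R * (1 + H) = 1 := Matrix.nonsing_inv_mul _ hu
  have e2 : (1 + H) * R = 1 := Matrix.mul_nonsing_inv _ hu
  have hHh : Hᴴ = H := hHp.1
  have hRh : Rᴴ = R := hRp.1
  have e3 : R * H = 1 - R := by
    rw [eq_sub_iff_add_eq, ← e1]; noncomm_ring
  have e4 : H * R = 1 - R := by
    rw [eq_sub_iff_add_eq, ← e2]; noncomm_ring
  refine ⟨(2 : ℂ) • (W * R), ?_, ?_⟩
  · have : (1 : Op n) - ((2 : ℂ) • (W * R))ᴴ * ((2 : ℂ) • (W * R))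
        = (R * (1 - H)) * (R * (1 - H))ᴴ := by
      have s1 : ((2 : ℂ) • (W * R))ᴴ * ((2 : ℂ) • (W * R)) = (4 : ℂ) • (R * H * R) := by
        simp only [Matrix.conjTranspose_smul, Matrix.conjTranspose_mul, hRh, Matrix.smul_mul,
          Matrix.mul_smul, smul_smul, hH, Matrix.mul_assoc]
        norm_num
      have s2 : R * (1 - H) = (2 : ℂ) • R - 1 := by
        rw [Matrix.mul_sub, e3, Matrix.mul_one, two_smul]; abel
      rw [s1, s2, e3]
      simp only [Matrix.conjTranspose_sub, Matrix.conjTranspose_smul, hRh,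
        Matrix.conjTranspose_one]
      simp only [Matrix.sub_mul, Matrix.mul_sub, Matrix.smul_mul, Matrix.mul_smul, Matrix.one_mul,
        Matrix.mul_one]
      simp
      module
    rw [this]
    exact Matrix.posSemidef_self_mul_conjTranspose _
  · have : (2 : ℂ) • (W * R) * Wᴴ - (2⁻¹ : ℂ) • ((3 : ℂ) • (W * Wᴴ) - (W * Wᴴ) * (W * Wᴴ))
        = (2⁻¹ : ℂ) • ((W * (1 - H)) * R * (W * (1 - H))ᴴ) := by
      have s1 : (1 - H) * R * (1 - H) = (4 : ℂ) • R - (3 : ℂ) • 1 + H := by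
        have : (1 - H) * R * (1 - H) = R - R * H - H * R + H * (R * H) := by noncomm_ring
        rw [this, e3, e4, Matrix.mul_sub, e4, Matrix.mul_one]
        module
      have s2 : (W * (1 - H)) * R * (W * (1 - H))ᴴ = W * ((1 - H) * R * (1 - H)) * Wᴴ := by
        rw [Matrix.conjTranspose_mul, Matrix.conjTranspose_sub, hHh, Matrix.conjTranspose_one]
        simp only [Matrix.mul_assoc]
      have s3 : (W * Wᴴ) * (W * Wᴴ) = W * H * Wᴴ := by
        simp only [hH, Matrix.mul_assoc]
      rw [s2, s1, s3]
      simp only [Matrix.mul_add, Matrix.mul_sub, Matrix.add_mul, Matrix.sub_mul, Matrix.mul_smul,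
        Matrix.smul_mul, Matrix.mul_one]
      module
    rw [this]
    refine (hRp.mul_mul_conjTranspose_same _).smul ?_
    norm_num [Complex.le_def]

end Basics

section Fidelity

variable {m : Type} [Fintype m] [DecidableEq m]

/-- A positive operator of rank at most one has only the eigenvalues `0` and its trace `t`, so that
its square root is `t ^ (-1/2)` times the operator. -/
theorem sqrt_vecMulVec_trace (v : m → ℂ) :
    (cfc Real.sqrt (vecMulVec v (star v))).trace.re = √ (star v ⬝ᵥ v).re := by
  set t : ℝ := (star v ⬝ᵥ v).re with ht
  have htv : star v ⬝ᵥ v = (t : ℂ) := star_dotProduct_self_eq v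
  set A : Op m := vecMulVec v (star v) with hA
  have hAp : A.PosSemidef := Matrix.posSemidef_vecMulVec_self_star v
  have hsa : IsSelfAdjoint A := hAp.1
  have htr : A.trace = t := by
    rw [hA, Matrix.trace_vecMulVec, dotProduct_comm, htv]
  have ht0 : 0 ≤ t := by
    have := re_trace_nonneg hAp
    rwa [htr, Complex.ofReal_re] at this
  have hAA : A * A = t • A := by
    rw [hA, Matrix.vecMulVec_mul_vecMulVec, htv]
    ext i j
    simp [Matrix.vecMulVec_apply]
    ring
  rcases ht0.eq_or_lt with h0 | hpos
  · have hA0 : A = 0 := (hAp.trace_eq_zero_iff).1 (by rw [htr, ← h0]; simp)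
    rw [hA0, cfc_apply_zero]
    simp [← h0]
  · have key : cfc Real.sqrt A = (√ t)⁻¹ • A := by
      have hsp : ∀ x ∈ spectrum ℝ A, x = 0 ∨ x = t := by
        intro x hx
        have h1 : cfc (fun y : ℝ => y * y - t * y) A = 0 := by
          rw [cfc_sub (fun y : ℝ => y * y) (fun y : ℝ => t * y) A,
            cfc_mul (fun y : ℝ => y) (fun y : ℝ => y) A, cfc_const_mul t (fun y : ℝ => y) A,
            cfc_id' ℝ A, hAA, sub_self]
        have h2 : x * x - t * x = 0 := by
          have h3 : x * x - t * x ∈ spectrum ℝ (cfc (fun y : ℝ => y * y - t * y) A) := by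
            rw [cfc_map_spectrum (fun y : ℝ => y * y - t * y) A]
            exact ⟨x, hx, rfl⟩
          rw [h1] at h3
          by_contra hne
          have h4 : IsUnit (algebraMap ℝ (Op m) (x * x - t * x)) :=
            (isUnit_iff_ne_zero.2 hne).map (algebraMap ℝ (Op m))
          rw [spectrum.mem_iff, sub_zero] at h3
          exact h3 h4
        have h5 : x * (x - t) = 0 := by linarith
        rcases mul_eq_zero.1 h5 with h | h
        · exact Or.inl h
        · exact Or.inr (by linarith)
      have : cfc Real.sqrt A = cfc (fun y : ℝ => (√ t)⁻¹ * y) A := by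
        refine cfc_congr fun x hx => ?_
        rcases hsp x hx with h | h
        · simp [h]
        · subst h
          have : √ t * √ t = t := Real.mul_self_sqrt ht0
          have hne : √ t ≠ 0 := (Real.sqrt_pos.2 hpos).ne'
          rw [← ht] at *
          field_simp
          rw [sq, this]
      rw [this, cfc_const_mul (√ t)⁻¹ (fun y : ℝ => y) A, cfc_id' ℝ A]
    rw [key, Matrix.trace_smul, htr, Complex.smul_re, Complex.ofReal_re, smul_eq_mul]
    have : √ t * √ t = t := Real.mul_self_sqrt ht0
    have hne : √ t ≠ 0 := (Real.sqrt_pos.2 hpos).ne'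
    field_simp
    rw [sq, this]

/-- The fidelity with a pure state. -/
theorem fidelity_vecMulVec {ρ : Op m} (hρ : ρ.PosSemidef) (ψ : m → ℂ) :
    fidelity ρ (vecMulVec ψ (star ψ)) = √ (star ψ ⬝ᵥ (ρ *ᵥ ψ)).re := by
  have hsa : IsSelfAdjoint ρ := hρ.1
  have hmul : cfc Real.sqrt ρ * cfc Real.sqrt ρ = ρ := by
    rw [← cfc_mul Real.sqrt Real.sqrt ρ]
    conv_rhs => rw [← cfc_id' ℝ ρ]
    refine cfc_congr fun x hx => ?_
    exact Real.mul_self_sqrt (spectrum_nonneg_of_nonneg hρ.nonneg hx)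
  set S := cfc Real.sqrt ρ with hS
  have hSh : Sᴴ = S := (cfc_predicate Real.sqrt ρ : IsSelfAdjoint _)
  have h1 : S * vecMulVec ψ (star ψ) * S = vecMulVec (S *ᵥ ψ) (star (S *ᵥ ψ)) := by
    rw [Matrix.mul_vecMulVec, Matrix.vecMulVec_mul, Matrix.star_mulVec, hSh]
  have h2 : star (S *ᵥ ψ) ⬝ᵥ (S *ᵥ ψ) = star ψ ⬝ᵥ (ρ *ᵥ ψ) := by
    rw [Matrix.star_mulVec, hSh, ← Matrix.dotProduct_mulVec, Matrix.mulVec_mulVec, hmul]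
  rw [fidelity, ← hS, h1, sqrt_vecMulVec_trace, h2]

end Fidelity

/-! ### Completely positive maps and LOCC protocols -/

section CompletelyPositive

variable {a a' a'' b b' c ι : Type}

/-- The map `X ↦ K X Kᴴ` with the single Kraus operator `K`. -/
def conjMap [Fintype a] (K : Matrix a' a ℂ) : Op a →ₗ[ℂ] Op a' where
  toFun X := K * X * Kᴴ
  map_add' X Y := by rw [Matrix.mul_add, Matrix.add_mul]
  map_smul' z X := by simp

/-- The map `X ↦ ∑ i, K i X (K i)ᴴ` with Kraus operators `K i`. -/
def krausMap [Fintype a] [Fintype ι] (K : ι → Matrix a' a ℂ) : Op a →ₗ[ℂ] Op a' :=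
  ∑ i, conjMap (K i)

@[simp] theorem conjMap_apply [Fintype a] (K : Matrix a' a ℂ) (X : Op a) :
    conjMap K X = K * X * Kᴴ := rfl

theorem krausMap_apply [Fintype a] [Fintype ι] (K : ι → Matrix a' a ℂ) (X : Op a) :
    krausMap K X = ∑ i, K i * X * (K i)ᴴ := by
  simp [krausMap]

theorem onRight_sum [Fintype ι] (Φ : ι → (Op a →ₗ[ℂ] Op a')) (X : Op (c × a)) :
    onRight c (∑ i, Φ i) X = ∑ i, onRight c (Φ i) X := by
  ext p q
  simp [onRight, Matrix.sum_apply]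

theorem onLeft_sum [Fintype ι] (Φ : ι → (Op a →ₗ[ℂ] Op a')) (X : Op (a × c)) :
    onLeft c (∑ i, Φ i) X = ∑ i, onLeft c (Φ i) X := by
  ext p q
  simp [onLeft, Matrix.sum_apply]

theorem onRight_add (Φ Φ' : Op a →ₗ[ℂ] Op a') (X : Op (c × a)) :
    onRight c (Φ + Φ') X = onRight c Φ X + onRight c Φ' X := rfl

theorem onRight_conjMap [Fintype a] [Fintype c] [DecidableEq c] (K : Matrix a' a ℂ)
    (X : Op (c × a)) :
    onRight c (conjMap K) X = ((1 : Op c) ⊗ₖ K) * X * ((1 : Op c) ⊗ₖ K)ᴴ := by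
  ext ⟨p, p'⟩ ⟨q, q'⟩
  simp [onRight, Matrix.mul_apply, Fintype.sum_prod_type, Matrix.one_apply, Finset.sum_mul,
    apply_ite]

theorem onLeft_conjMap [Fintype a] [Fintype c] [DecidableEq c] (K : Matrix a' a ℂ)
    (X : Op (a × c)) :
    onLeft c (conjMap K) X = (K ⊗ₖ (1 : Op c)) * X * (K ⊗ₖ (1 : Op c))ᴴ := by
  ext ⟨p, p'⟩ ⟨q, q'⟩
  simp [onLeft, Matrix.mul_apply, Fintype.sum_prod_type, Matrix.one_apply, Finset.sum_mul,
    apply_ite]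

theorem isCP_conjMap [Fintype a] [Fintype a'] (K : Matrix a' a ℂ) : IsCP (conjMap K) := by
  intro k X hX
  rw [onRight_conjMap]
  exact hX.mul_mul_conjTranspose_same _

theorem IsCP.sum [Fintype ι] {Φ : ι → (Op a →ₗ[ℂ] Op a')} (h : ∀ i, IsCP (Φ i)) :
    IsCP (∑ i, Φ i) := by
  intro k X hX
  rw [onRight_sum]
  exact Matrix.posSemidef_sum _ fun i _ => h i k X hX

theorem IsCP.comp {Φ : Op a →ₗ[ℂ] Op a'} {Φ' : Op a' →ₗ[ℂ] Op a''} (h' : IsCP Φ')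
    (h : IsCP Φ) : IsCP (Φ' ∘ₗ Φ) :=
  fun k X hX => h' k _ (h k X hX)

theorem isCP_krausMap [Fintype a] [Fintype a'] [Fintype ι] (K : ι → Matrix a' a ℂ) :
    IsCP (krausMap K) :=
  IsCP.sum fun i => isCP_conjMap (K i)

theorem isTP_krausMap [Fintype a] [DecidableEq a] [Fintype a'] [Fintype ι]
    {K : ι → Matrix a' a ℂ} (h : ∑ i, (K i)ᴴ * K i = 1) : IsTP (krausMap K) := by
  intro X
  rw [krausMap_apply, Matrix.trace_sum]
  calc ∑ i, (K i * X * (K i)ᴴ).trace = ∑ i, (((K i)ᴴ * K i) * X).trace :=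
        Finset.sum_congr rfl fun i _ => Matrix.trace_mul_cycle _ _ _
    _ = ((∑ i, (K i)ᴴ * K i) * X).trace := by rw [Matrix.sum_mul, Matrix.trace_sum]
    _ = X.trace := by rw [h, Matrix.one_mul]

theorem IsCP.onRight_posSemidef [Fintype c] {Φ : Op a →ₗ[ℂ] Op a'} (h : IsCP Φ)
    {X : Op (c × a)} (hX : X.PosSemidef) : (onRight c Φ X).PosSemidef := by
  let e := Fintype.equivFin c
  have h1 := h _ _ (hX.submatrix (Prod.map e.symm id))
  have h2 := h1.submatrix (Prod.map e id)
  convert h2 using 1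
  ext p q
  simp [onRight]

theorem IsCP.onLeft_posSemidef [Fintype c] {Φ : Op a →ₗ[ℂ] Op a'} (h : IsCP Φ)
    {X : Op (a × c)} (hX : X.PosSemidef) : (onLeft c Φ X).PosSemidef :=
  (h.onRight_posSemidef (hX.submatrix Prod.swap)).submatrix Prod.swap

theorem IsCP.posSemidef {Φ : Op a →ₗ[ℂ] Op a'} (h : IsCP Φ)
    {X : Op a} (hX : X.PosSemidef) : (Φ X).PosSemidef := by
  have h1 := h 1 _ (hX.submatrix Prod.snd)
  exact h1.submatrix fun i => (0, i)

theorem trace_onRight [Fintype a'] [Fintype c] (Φ : Op a →ₗ[ℂ] Op a') (X : Op (c × a)) :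
    (onRight c Φ X).trace = ∑ i, (Φ (X.submatrix (Prod.mk i) (Prod.mk i))).trace := by
  simp only [Matrix.trace, Fintype.sum_prod_type]
  rfl

theorem trace_onLeft [Fintype a'] [Fintype c] (Φ : Op a →ₗ[ℂ] Op a') (X : Op (a × c)) :
    (onLeft c Φ X).trace = ∑ i, (Φ (X.submatrix (fun j => (j, i)) fun j => (j, i))).trace := by
  simp only [Matrix.trace, Fintype.sum_prod_type_right]
  rfl

theorem IsTP.onRight [Fintype a] [Fintype a'] [Fintype c] {Φ : Op a →ₗ[ℂ] Op a'} (h : IsTP Φ) :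
    IsTP (onRight c Φ) := by
  intro X
  rw [trace_onRight]
  simp only [h _]
  simp only [Matrix.trace, Fintype.sum_prod_type]
  rfl

theorem IsTP.onLeft [Fintype a] [Fintype a'] [Fintype c] {Φ : Op a →ₗ[ℂ] Op a'} (h : IsTP Φ) :
    IsTP (onLeft c Φ) := by
  intro X
  rw [trace_onLeft]
  simp only [h _]
  simp only [Matrix.trace, Fintype.sum_prod_type_right]
  rfl

theorem IsTP.sum_trace [Fintype a] [Fintype a'] [Fintype ι] {E : ι → (Op a →ₗ[ℂ] Op a')}
    (h : IsTP (∑ x, E x)) (X : Op a) : ∑ x, (E x X).trace = X.trace := by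
  rw [← h X, LinearMap.sum_apply, Matrix.trace_sum]

theorem IsTP.sum_trace_onLeft [Fintype a] [Fintype a'] [Fintype c] [Fintype ι]
    {E : ι → (Op a →ₗ[ℂ] Op a')} (h : IsTP (∑ x, E x)) (X : Op (a × c)) :
    ∑ x, (Distill.onLeft c (E x) X).trace = X.trace := by
  rw [← (IsTP.onLeft h : IsTP (Distill.onLeft c _)) X, onLeft_sum, Matrix.trace_sum]

theorem IsTP.sum_trace_onRight [Fintype a] [Fintype a'] [Fintype c] [Fintype ι]
    {E : ι → (Op a →ₗ[ℂ] Op a')} (h : IsTP (∑ x, E x)) (X : Op (c × a)) :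
    ∑ x, (Distill.onRight c (E x) X).trace = X.trace := by
  rw [← (IsTP.onRight h : IsTP (Distill.onRight c _)) X, onRight_sum, Matrix.trace_sum]

end CompletelyPositive

section LOCC

variable {a b a' b' a'' b'' : Type}

theorem IsTwoWayLOCC.posSemidef_and_isTP [Fintype a'] [Fintype b']
    {Λ : Op (a × b) →ₗ[ℂ] Op (a' × b')} (h : IsTwoWayLOCC Λ) [Fintype a] [Fintype b] :
    (∀ X : Op (a × b), X.PosSemidef → (Λ X).PosSemidef) ∧ IsTP Λ := by
  -- The constructors of `IsTwoWayLOCC` carry their own `Fintype` instances.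
  rename_i i1 i2
  revert i1 i2
  induction h with
  | done =>
    intro i1 i2
    refine ⟨fun X hX => hX, fun X => ?_⟩
    simp only [LinearMap.id_apply]
    congr!
  | @alice a b i0 d k E hE Λ hΛ ih =>
    intro i1 i2
    obtain rfl := Subsingleton.elim i0 i1
    refine ⟨fun X hX => ?_, fun X => ?_⟩
    · rw [LinearMap.sum_apply]
      exact Matrix.posSemidef_sum _ fun x _ => ih x |>.1 _ ((hE.1 x).onLeft_posSemidef hX)
    · rw [LinearMap.sum_apply, Matrix.trace_sum]
      have h2 := IsTP.sum_trace_onLeft hE.2 X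
      simp only [LinearMap.comp_apply, (ih _).2 _, h2]
  | @bob a b i0 d k E hE Λ hΛ ih =>
    intro i1 i2
    obtain rfl := Subsingleton.elim i0 i2
    refine ⟨fun X hX => ?_, fun X => ?_⟩
    · rw [LinearMap.sum_apply]
      exact Matrix.posSemidef_sum _ fun x _ => ih x |>.1 _ ((hE.1 x).onRight_posSemidef hX)
    · rw [LinearMap.sum_apply, Matrix.trace_sum]
      have h2 := IsTP.sum_trace_onRight hE.2 X
      simp only [LinearMap.comp_apply, (ih _).2 _, h2]

/-- The second protocol is run in every branch at which the first one stops. -/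
theorem IsTwoWayLOCC.comp {Λ' : Op (a' × b') →ₗ[ℂ] Op (a'' × b'')} (h' : IsTwoWayLOCC Λ')
    {Λ : Op (a × b) →ₗ[ℂ] Op (a' × b')} (h : IsTwoWayLOCC Λ) : IsTwoWayLOCC (Λ' ∘ₗ Λ) := by
  induction h with
  | done => simpa using h'
  | alice E hE Λ hΛ ih =>
    have := IsTwoWayLOCC.alice E hE _ ih
    convert this using 1
    ext1 X
    simp
  | bob E hE Λ hΛ ih =>
    have := IsTwoWayLOCC.bob E hE _ ih
    convert this using 1
    ext1 X
    simp

/-- After Alice's announcement, Bob applies an instrument with a single outcome. -/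
theorem IsOneWayLOCC.isTwoWayLOCC [Fintype a] [Fintype b] {dA dB : ℕ}
    {Λ : Op (a × b) →ₗ[ℂ] Op (Fin dA × Fin dB)} (h : IsOneWayLOCC Λ) : IsTwoWayLOCC Λ := by
  obtain ⟨k, E, D, hE, hD, rfl⟩ := h
  refine IsTwoWayLOCC.alice E hE (fun x => onRight (Fin dA) (D x)) fun x => ?_
  have := IsTwoWayLOCC.bob (a := Fin dA) (fun _ : Fin 1 => D x) (d := dB)
    ⟨fun _ => (hD x).1, by simpa using (hD x).2⟩ (fun _ => LinearMap.id)
    (fun _ => IsTwoWayLOCC.done)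
  simpa using this

theorem isOneWayLOCC_sum {ι : Type} [Fintype a] [Fintype b] [Fintype a'] [Fintype b'] [Fintype ι]
    (E : ι → (Op a →ₗ[ℂ] Op a')) (D : ι → (Op b →ₗ[ℂ] Op b')) (hE : ∀ x, IsCP (E x))
    (hE' : IsTP (∑ x, E x)) (hD : ∀ x, IsCP (D x) ∧ IsTP (D x)) :
    IsOneWayLOCC (∑ x, onRight a' (D x) ∘ₗ onLeft b (E x)) := by
  let e := Fintype.equivFin ι
  refine ⟨_, fun i => E (e.symm i), fun i => D (e.symm i), ⟨fun x => hE _, ?_⟩, fun x => hD _, ?_⟩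
  · rwa [e.symm.sum_comp]
  · exact (e.symm.sum_comp fun x => onRight a' (D x) ∘ₗ onLeft b (E x)).symm

theorem IsOneWayLOCC.posSemidef_and_isTP [Fintype a] [Fintype b] [Fintype a'] [Fintype b']
    {Λ : Op (a × b) →ₗ[ℂ] Op (a' × b')} (h : IsOneWayLOCC Λ) :
    (∀ X : Op (a × b), X.PosSemidef → (Λ X).PosSemidef) ∧ IsTP Λ := by
  obtain ⟨k, E, D, hE, hD, rfl⟩ := h
  refine ⟨fun X hX => ?_, fun X => ?_⟩
  · rw [LinearMap.sum_apply]
    exact Matrix.posSemidef_sum _ fun x _ =>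
      (hD x).1.onRight_posSemidef ((hE.1 x).onLeft_posSemidef hX)
  · rw [LinearMap.sum_apply, Matrix.trace_sum]
    simp only [LinearMap.comp_apply, ((hD _).2.onRight : IsTP (onRight a' _)) _]
    exact hE.2.sum_trace_onLeft X

end LOCC

section Output

variable {a a' b : Type}

/-- The embedding `X ↦ X ⊗ |x⟩⟨x|`. -/
def tagMap (b : Type) [Fintype b] [DecidableEq b] {k : ℕ} (x : Fin k) : Op b →ₗ[ℂ] Op (b × Fin k) :=
  conjMap (Matrix.of fun p j => if p = (j, x) then 1 else 0)

theorem tagMap_apply [Fintype b] [DecidableEq b] {k : ℕ} (x : Fin k) (X : Op b)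
    (p q : b × Fin k) :
    tagMap b x X p q = if p.2 = x ∧ q.2 = x then X p.1 q.1 else 0 := by
  obtain ⟨p, y⟩ := p
  obtain ⟨q, z⟩ := q
  simp only [tagMap, conjMap_apply, Matrix.mul_apply, Matrix.of_apply, Prod.mk.injEq,
    Matrix.conjTranspose_apply]
  by_cases hy : y = x <;> by_cases hz : z = x <;> simp [hy, hz]

theorem isTP_tagMap [Fintype b] [DecidableEq b] {k : ℕ} (x : Fin k) : IsTP (tagMap b x) := by
  intro X
  simp only [Matrix.trace, Matrix.diag, tagMap_apply, and_self]
  simp [Fintype.sum_prod_type]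

theorem onLeft_onRight_tagMap [Fintype b] [DecidableEq b] {k : ℕ} (x : Fin k)
    (E : Op a →ₗ[ℂ] Op a') (Y : Op (a × b)) :
    onLeft (b × Fin k) E (onRight a (tagMap b x) Y)
      = onRight a' (tagMap b x) (onLeft b E Y) := by
  ext ⟨p, p'⟩ ⟨q, q'⟩
  simp only [onLeft, onRight, LinearMap.coe_mk, AddHom.coe_mk, Matrix.of_apply, tagMap_apply]
  split_ifs with h
  · rfl
  · exact congrFun (congrFun (map_zero E) p) q

theorem Instrument.output_eq_sum [Fintype a] [Fintype b] [DecidableEq b] (I : Instrument a)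
    (ρ : Op (a × b)) :
    I.output ρ = ∑ x, onRight (Fin I.dim) (tagMap b x) (onLeft b (I.map x) ρ) := by
  ext ⟨p, p', x⟩ ⟨q, q', y⟩
  simp only [Instrument.output, Matrix.of_apply, Matrix.sum_apply, onRight, LinearMap.coe_mk,
    AddHom.coe_mk, tagMap_apply]
  by_cases h : x = y
  · subst h
    simp
  · rw [if_neg h]
    refine (Finset.sum_eq_zero fun z _ => if_neg ?_).symm
    rintro ⟨rfl, rfl⟩
    exact h rfl

/-- A one-way protocol run on the output of an instrument, whose register is handed to Bob, is a
one-way protocol on the input. -/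
theorem IsOneWayLOCC.comp_output [Fintype a] [Fintype b] [DecidableEq b] (I : Instrument a)
    {dA dB : ℕ}
    {Λ : Op (Fin I.dim × (b × Fin I.card)) →ₗ[ℂ] Op (Fin dA × Fin dB)} (h : IsOneWayLOCC Λ) :
    ∃ Λ' : Op (a × b) →ₗ[ℂ] Op (Fin dA × Fin dB), IsOneWayLOCC Λ' ∧
      ∀ ρ, Λ' ρ = Λ (I.output ρ) := by
  obtain ⟨k, E, D, hE, hD, rfl⟩ := h
  refine ⟨_, isOneWayLOCC_sum (ι := Fin I.card × Fin k) (fun p => E p.2 ∘ₗ I.map p.1)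
    (fun p => D p.2 ∘ₗ tagMap b p.1) (fun p => (hE.1 _).comp (I.isInstrument.1 _)) ?_ ?_, ?_⟩
  · intro X
    rw [LinearMap.sum_apply, Matrix.trace_sum, Fintype.sum_prod_type]
    simp only [LinearMap.comp_apply, hE.2.sum_trace]
    exact I.isInstrument.2.sum_trace X
  · intro p
    refine ⟨(hD _).1.comp (isCP_conjMap _), fun X => ?_⟩
    rw [LinearMap.comp_apply, (hD _).2, isTP_tagMap]
  · intro ρ
    rw [I.output_eq_sum]
    simp only [LinearMap.sum_apply, map_sum, Fintype.sum_prod_type]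
    refine Finset.sum_congr rfl fun x _ => Finset.sum_congr rfl fun y _ => ?_
    rw [LinearMap.comp_apply, LinearMap.comp_apply, onLeft_onRight_tagMap]
    rfl

theorem Instrument.output_isState [Fintype a] [Fintype b] [DecidableEq b] (I : Instrument a)
    {ρ : Op (a × b)} (hρ : IsState ρ) : IsState (I.output ρ) := by
  rw [I.output_eq_sum]
  refine ⟨Matrix.posSemidef_sum _ fun x _ => (isCP_conjMap _).onRight_posSemidef
    ((I.isInstrument.1 x).onLeft_posSemidef hρ.1), ?_⟩
  rw [← hρ.2, ← I.isInstrument.2.sum_trace_onLeft ρ, Matrix.trace_sum]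
  exact Finset.sum_congr rfl fun x _ => (isTP_tagMap x).onRight _

end Output

/-! ### Random phases -/

section Phases

variable {ι : Type}

/-- The cube root of unity attached to the coordinate `p` of `u`. For uniformly random `u` these
are independent, with `E z = E z² = 0` and `|z| = 1`. -/
def phase (u : ι → ZMod 3) (p : ι) : ℂ := ZMod.stdAddChar (u p)

theorem star_phase (u : ι → ZMod 3) (p : ι) : star (phase u p) = ZMod.stdAddChar (-u p) :=
  (AddChar.map_neg_eq_conj _ _).symm

variable [Fintype ι] [DecidableEq ι]

/-- Second moment of the random phases. -/
theorem sum_phase_two (p q : ι) :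
    ∑ u : ι → ZMod 3, star (phase u p) * phase u q
      = if p = q then (Fintype.card (ι → ZMod 3) : ℂ) else 0 := by
  let φ : (ι → ZMod 3) →+ ZMod 3 :=
    -Pi.evalAddMonoidHom (fun _ : ι => ZMod 3) p + Pi.evalAddMonoidHom (fun _ : ι => ZMod 3) q
  have h1 : ∀ u, star (phase u p) * phase u q
      = (ZMod.stdAddChar.compAddMonoidHom φ : AddChar _ ℂ) u := by
    intro u
    rw [star_phase, phase, ← AddChar.map_add_eq_mul]
    rfl
  classical
  rw [Finset.sum_congr rfl fun u _ => h1 u, AddChar.sum_eq_ite]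
  congr 1
  rw [eq_iff_iff]
  constructor
  · intro h
    have h2 : ZMod.stdAddChar (φ (Pi.single p 1)) = (1 : ℂ) := DFunLike.congr_fun h (Pi.single p 1)
    rw [← AddChar.map_zero_eq_one (ZMod.stdAddChar : AddChar (ZMod 3) ℂ)] at h2
    have h3 := ZMod.injective_stdAddChar h2
    by_contra hne
    simp [φ, Ne.symm hne] at h3
  · rintro rfl
    ext u
    simp [φ]

/-- Fourth moment of the random phases: the two pairings of conjugated with unconjugated phases. -/
theorem sum_phase_four (p q r s : ι) :
    ∑ u : ι → ZMod 3, star (phase u p) * phase u q * (star (phase u r) * phase u s)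
      = if (p = q ∧ r = s) ∨ (p = s ∧ r = q) then (Fintype.card (ι → ZMod 3) : ℂ) else 0 := by
  let φ : (ι → ZMod 3) →+ ZMod 3 :=
    -Pi.evalAddMonoidHom (fun _ : ι => ZMod 3) p + Pi.evalAddMonoidHom (fun _ : ι => ZMod 3) q
    + (-Pi.evalAddMonoidHom (fun _ : ι => ZMod 3) r + Pi.evalAddMonoidHom (fun _ : ι => ZMod 3) s)
  have h1 : ∀ u, star (phase u p) * phase u q * (star (phase u r) * phase u s)
      = (ZMod.stdAddChar.compAddMonoidHom φ : AddChar _ ℂ) u := by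
    intro u
    rw [star_phase, phase, star_phase, phase, ← AddChar.map_add_eq_mul, ← AddChar.map_add_eq_mul,
      ← AddChar.map_add_eq_mul]
    rfl
  classical
  rw [Finset.sum_congr rfl fun u _ => h1 u, AddChar.sum_eq_ite]
  congr 1
  rw [eq_iff_iff]
  constructor
  · intro h
    have h4 : ∀ x : ι, φ (Pi.single x 1) = 0 := by
      intro x
      have h2 : ZMod.stdAddChar (φ (Pi.single x 1)) = (1 : ℂ) :=
        DFunLike.congr_fun h (Pi.single x 1)
      rw [← AddChar.map_zero_eq_one (ZMod.stdAddChar : AddChar (ZMod 3) ℂ)] at h2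
      exact ZMod.injective_stdAddChar h2
    have hp := h4 p
    have hr := h4 r
    simp only [φ, Pi.single_apply, AddMonoidHom.add_apply, AddMonoidHom.neg_apply,
      Pi.evalAddMonoidHom_apply] at hp hr
    clear h h4 h1 φ
    split_ifs at hp hr <;> first
      | exact absurd hp (by decide)
      | exact absurd hr (by decide)
      | (subst_vars; simp; done)
      | simp_all
  · rintro (⟨rfl, rfl⟩ | ⟨rfl, rfl⟩)
    · ext u
      simp [φ]
    · ext u
      simp [φ, AddChar.compAddMonoidHom_apply]

end Phases

/-! ### Moments of the random code -/

section PartialTrace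

variable {a b : Type} [Fintype a]

/-- The partial trace over the first factor. -/
def partialTrace (X : Op (a × b)) : Op b :=
  Matrix.of fun j j' => ∑ i, X (i, j) (i, j')

theorem trace_partialTrace [Fintype b] (X : Op (a × b)) : (partialTrace X).trace = X.trace := by
  simp only [Matrix.trace, Fintype.sum_prod_type_right]
  rfl

theorem trace_mul_one_kronecker [Fintype b] [DecidableEq a] (Y : Op (a × b)) (X : Op b) :
    (Y * ((1 : Op a) ⊗ₖ X)).trace = (partialTrace Y * X).trace := by
  simp only [Matrix.trace, Matrix.diag, Matrix.mul_apply, Fintype.sum_prod_type, partialTrace,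
    Matrix.of_apply, Matrix.kroneckerMap_apply, Matrix.one_apply, ite_mul, one_mul, zero_mul,
    mul_ite, mul_zero, Finset.sum_mul]
  simp only [Finset.sum_comm (s := (Finset.univ : Finset b)) (t := (Finset.univ : Finset a))]
  simp

theorem partialTrace_posSemidef {X : Op (a × b)} (hX : X.PosSemidef) :
    (partialTrace X).PosSemidef := by
  have h : partialTrace X = ∑ i, X.submatrix (Prod.mk i) (Prod.mk i) := by
    ext j j'
    simp [partialTrace, Matrix.sum_apply]
  rw [h]
  exact Matrix.posSemidef_sum _ fun i _ => hX.submatrix _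

end PartialTrace

section Pairings

variable {a : Type} [Fintype a] [DecidableEq a]

theorem ite_or_add_ite_and (p q : Prop) [Decidable p] [Decidable q] (z : ℂ) :
    (if p ∨ q then z else 0) + (if p ∧ q then z else 0)
      = (if p then z else 0) + (if q then z else 0) := by
  by_cases hp : p <;> by_cases hq : q <;> simp [hp, hq]

theorem sum_pairing_left (M : ℕ) (z : ℂ) (F G : a → a → ℂ) :
    ∑ _i : Fin M, ∑ k, ∑ k', ∑ _l : Fin M, ∑ m, ∑ m',
      (if k = k' ∧ m = m' then z else 0) * (F k k' * G m m')
      = z * M ^ 2 * ((∑ k, F k k) * ∑ m, G m m) := by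
  have h1 : ∀ k : a, ∑ k', ∑ _l : Fin M, ∑ m, ∑ m',
      (if k = k' ∧ m = m' then z else 0) * (F k k' * G m m')
      = M * (z * (F k k * ∑ m, G m m)) := by
    intro k
    rw [Fintype.sum_eq_single k fun k' hk => Finset.sum_eq_zero fun _ _ =>
      Finset.sum_eq_zero fun _ _ => Finset.sum_eq_zero fun _ _ => by
        rw [if_neg fun h => hk h.1.symm, zero_mul]]
    have h2 : ∀ m : a, ∑ m', (if k = k ∧ m = m' then z else 0) * (F k k * G m m')
        = z * (F k k * G m m) := by
      intro m
      rw [Fintype.sum_eq_single m fun m' hm => by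
        rw [if_neg fun h => hm h.2.symm, zero_mul]]
      simp
    rw [Finset.sum_congr rfl fun _ _ => Finset.sum_congr rfl fun m _ => h2 m]
    simp only [Finset.sum_const, Finset.card_univ, Fintype.card_fin, nsmul_eq_mul, Finset.mul_sum]
  rw [Finset.sum_congr rfl fun _ _ => Finset.sum_congr rfl fun k _ => h1 k]
  simp only [Finset.sum_const, Finset.card_univ, Fintype.card_fin, nsmul_eq_mul]
  simp only [← Finset.mul_sum, ← Finset.sum_mul]
  ring

theorem sum_pairing_right (M : ℕ) (z : ℂ) (F G : a → a → ℂ) :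
    ∑ i : Fin M, ∑ k, ∑ k', ∑ l : Fin M, ∑ m, ∑ m',
      (if (i = l ∧ k = m') ∧ (l = i ∧ m = k') then z else 0) * (F k k' * G m m')
      = z * M * ∑ k, ∑ k', F k k' * G k' k := by
  have h1 : ∀ (i : Fin M) (k k' : a), ∑ l : Fin M, ∑ m, ∑ m',
      (if (i = l ∧ k = m') ∧ (l = i ∧ m = k') then z else 0) * (F k k' * G m m')
      = z * (F k k' * G k' k) := by
    intro i k k'
    rw [Fintype.sum_eq_single i fun l hl => Finset.sum_eq_zero fun _ _ =>
      Finset.sum_eq_zero fun _ _ => by rw [if_neg fun h => hl h.2.1, zero_mul],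
      Fintype.sum_eq_single k' fun m hm => Finset.sum_eq_zero fun _ _ => by
        rw [if_neg fun h => hm h.2.2, zero_mul],
      Fintype.sum_eq_single k fun m hm => by rw [if_neg fun h => hm h.1.2.symm, zero_mul]]
    simp
  simp only [h1, Finset.sum_const, Finset.card_univ, Fintype.card_fin, nsmul_eq_mul]
  simp only [← Finset.mul_sum]
  ring

theorem sum_pairing_both (M : ℕ) (z : ℂ) (F G : a → a → ℂ) :
    ∑ i : Fin M, ∑ k, ∑ k', ∑ l : Fin M, ∑ m, ∑ m',
      (if (k = k' ∧ m = m') ∧ ((i = l ∧ k = m') ∧ (l = i ∧ m = k')) then z else 0)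
        * (F k k' * G m m')
      = z * M * ∑ k, F k k * G k k := by
  have h1 : ∀ (i : Fin M) (k : a), ∑ k', ∑ l : Fin M, ∑ m, ∑ m',
      (if (k = k' ∧ m = m') ∧ ((i = l ∧ k = m') ∧ (l = i ∧ m = k')) then z else 0)
        * (F k k' * G m m')
      = z * (F k k * G k k) := by
    intro i k
    rw [Fintype.sum_eq_single k fun l hl => Finset.sum_eq_zero fun _ _ =>
      Finset.sum_eq_zero fun _ _ => Finset.sum_eq_zero fun _ _ => by
        rw [if_neg fun h => hl h.1.1.symm, zero_mul],
      Fintype.sum_eq_single i fun l hl => Finset.sum_eq_zero fun _ _ =>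
        Finset.sum_eq_zero fun _ _ => by rw [if_neg fun h => hl h.2.2.1, zero_mul],
      Fintype.sum_eq_single k fun m hm => Finset.sum_eq_zero fun _ _ => by
        rw [if_neg fun h => hm h.2.2.2, zero_mul],
      Fintype.sum_eq_single k fun m hm => by rw [if_neg fun h => hm h.1.2.symm, zero_mul]]
    simp
  simp only [h1, Finset.sum_const, Finset.card_univ, Fintype.card_fin, nsmul_eq_mul]
  simp only [← Finset.mul_sum]
  ring

end Pairings

section Gram

variable {a b : Type} [Fintype a] [Fintype b] [DecidableEq b] {M : ℕ}

/-- The operator `∑ i, |i⟩ ⊗ |z i⟩ ⊗ 1_b`, where the components of the vectors `z i` are the random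
phases. -/
def codeMatrix (b : Type) [DecidableEq b] (u : Fin M × a → ZMod 3) :
    Matrix (Fin M × (a × b)) b ℂ :=
  Matrix.of fun p j => if p.2.2 = j then phase u (p.1, p.2.1) else 0

/-- The operator `∑ i, ⟨z i| X |z i⟩` on `b`. -/
def codeGram (u : Fin M × a → ZMod 3) (X : Op (a × b)) : Op b :=
  (codeMatrix b u)ᴴ * ((1 : Op (Fin M)) ⊗ₖ X) * codeMatrix b u

theorem codeGram_apply (u : Fin M × a → ZMod 3) (X : Op (a × b)) (j j' : b) :
    codeGram u X j j'
      = ∑ i, ∑ k, ∑ k', star (phase u (i, k)) * phase u (i, k') * X (k, j) (k', j') := by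
  simp only [codeGram, codeMatrix, Matrix.mul_apply, Fintype.sum_prod_type, Matrix.of_apply,
    Matrix.conjTranspose_apply, Matrix.kroneckerMap_apply, Matrix.one_apply]
  simp [apply_ite, Finset.sum_mul]
  refine Finset.sum_congr rfl fun i _ => ?_
  rw [Finset.sum_comm]
  refine Finset.sum_congr rfl fun k _ => Finset.sum_congr rfl fun k' _ => ?_
  ring

theorem sum_trace_codeGram [DecidableEq a] (X : Op (a × b)) :
    ∑ u : Fin M × a → ZMod 3, (codeGram u X).trace
      = (Fintype.card (Fin M × a → ZMod 3) : ℂ) * M * X.trace := by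
  have h : ∀ u : Fin M × a → ZMod 3, (codeGram u X).trace
      = ∑ j, ∑ i, ∑ k, ∑ k', star (phase u (i, k)) * phase u (i, k') * X (k, j) (k', j) :=
    fun u => Finset.sum_congr rfl fun j _ => codeGram_apply u X j j
  simp only [h]
  rw [Finset.sum_comm]
  have h2 : ∀ j : b, ∑ u : Fin M × a → ZMod 3,
      ∑ i, ∑ k, ∑ k', star (phase u (i, k)) * phase u (i, k') * X (k, j) (k', j)
      = ∑ i, ∑ k, ∑ k', (∑ u : Fin M × a → ZMod 3,
        star (phase u (i, k)) * phase u (i, k')) * X (k, j) (k', j) := by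
    intro j
    rw [Finset.sum_comm]
    refine Finset.sum_congr rfl fun i _ => ?_
    rw [Finset.sum_comm]
    refine Finset.sum_congr rfl fun k _ => ?_
    rw [Finset.sum_comm]
    refine Finset.sum_congr rfl fun k' _ => ?_
    rw [Finset.sum_mul]
  simp only [h2, sum_phase_two, Prod.mk.injEq, true_and, ite_mul, zero_mul, Finset.sum_ite_eq,
    Finset.mem_univ, if_true]
  simp only [Matrix.trace, Matrix.diag, Fintype.sum_prod_type_right, Finset.mul_sum,
    Finset.sum_const, Finset.card_univ, Fintype.card_fin, nsmul_eq_mul]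
  refine Finset.sum_congr rfl fun i _ => Finset.sum_congr rfl fun k _ => ?_
  ring

/-- Second moment of `codeGram`. The two terms on the right come from the two pairings of the
phases; the pairings overlap, which is compensated by the second term on the left. -/
theorem sum_trace_codeGram_mul [DecidableEq a] (X P : Op (a × b)) :
    ∑ u : Fin M × a → ZMod 3, (codeGram u X * codeGram u P).trace
      + (Fintype.card (Fin M × a → ZMod 3) : ℂ) * M *
        ∑ k, (X.submatrix (Prod.mk k) (Prod.mk k) * P.submatrix (Prod.mk k) (Prod.mk k)).trace
      = (Fintype.card (Fin M × a → ZMod 3) : ℂ) * M ^ 2 *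
          (partialTrace X * partialTrace P).trace
        + (Fintype.card (Fin M × a → ZMod 3) : ℂ) * M * (X * P).trace := by
  set n : ℂ := (Fintype.card (Fin M × a → ZMod 3) : ℂ) with hn
  have h : ∀ u : Fin M × a → ZMod 3, (codeGram u X * codeGram u P).trace
      = ∑ j, ∑ j', ∑ i, ∑ k, ∑ k', ∑ l, ∑ m, ∑ m',
        (star (phase u (i, k)) * phase u (i, k') * (star (phase u (l, m)) * phase u (l, m')))
          * (X (k, j) (k', j') * P (m, j') (m', j)) := by
    intro u
    simp only [Matrix.trace, Matrix.diag, Matrix.mul_apply, codeGram_apply, Finset.sum_mul]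
    refine Finset.sum_congr rfl fun j _ => Finset.sum_congr rfl fun j' _ =>
      Finset.sum_congr rfl fun i _ => Finset.sum_congr rfl fun k _ =>
      Finset.sum_congr rfl fun k' _ => ?_
    simp only [Finset.mul_sum]
    refine Finset.sum_congr rfl fun l _ => Finset.sum_congr rfl fun m _ =>
      Finset.sum_congr rfl fun m' _ => ?_
    ring
  have h2 : ∑ u : Fin M × a → ZMod 3, (codeGram u X * codeGram u P).trace
      = ∑ j, ∑ j', ∑ i : Fin M, ∑ k, ∑ k', ∑ l : Fin M, ∑ m, ∑ m',
        (if (k = k' ∧ m = m') ∨ ((i = l ∧ k = m') ∧ (l = i ∧ m = k')) then n else 0)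
          * (X (k, j) (k', j') * P (m, j') (m', j)) := by
    simp only [h]
    rw [Finset.sum_comm]; refine Finset.sum_congr rfl fun j _ => ?_
    rw [Finset.sum_comm]; refine Finset.sum_congr rfl fun j' _ => ?_
    rw [Finset.sum_comm]; refine Finset.sum_congr rfl fun i _ => ?_
    rw [Finset.sum_comm]; refine Finset.sum_congr rfl fun k _ => ?_
    rw [Finset.sum_comm]; refine Finset.sum_congr rfl fun k' _ => ?_
    rw [Finset.sum_comm]; refine Finset.sum_congr rfl fun l _ => ?_
    rw [Finset.sum_comm]; refine Finset.sum_congr rfl fun m _ => ?_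
    rw [Finset.sum_comm]; refine Finset.sum_congr rfl fun m' _ => ?_
    rw [← Finset.sum_mul, sum_phase_four]
    simp only [Prod.mk.injEq, true_and, hn]
  have h3 : ∑ u : Fin M × a → ZMod 3, (codeGram u X * codeGram u P).trace
      + ∑ j, ∑ j', n * M * ∑ k, X (k, j) (k, j') * P (k, j') (k, j)
      = ∑ j, ∑ j', n * M ^ 2 * ((∑ k, X (k, j) (k, j')) * ∑ m, P (m, j') (m, j))
        + ∑ j, ∑ j', n * M * ∑ k, ∑ k', X (k, j) (k', j') * P (k', j') (k, j) := by
    rw [h2]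
    simp only [← Finset.sum_add_distrib]
    refine Finset.sum_congr rfl fun j _ => Finset.sum_congr rfl fun j' _ => ?_
    have e1 := sum_pairing_left M n (fun k k' => X (k, j) (k', j')) (fun m m' => P (m, j') (m', j))
    have e2 := sum_pairing_right M n (fun k k' => X (k, j) (k', j')) (fun m m' => P (m, j') (m', j))
    have e3 := sum_pairing_both M n (fun k k' => X (k, j) (k', j')) (fun m m' => P (m, j') (m', j))
    rw [← e1, ← e2, ← e3]
    simp only [← Finset.sum_add_distrib, ← add_mul, ite_or_add_ite_and]
  simp only [← Finset.mul_sum] at h3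
  convert h3 using 3
  · simp only [Matrix.trace, Matrix.diag, Matrix.mul_apply, Matrix.submatrix_apply]
    rw [Finset.sum_comm]
    exact Finset.sum_congr rfl fun j _ => Finset.sum_comm
  · simp only [Matrix.trace, Matrix.diag, Matrix.mul_apply]
    rfl
  · simp only [Matrix.trace, Matrix.diag, Matrix.mul_apply, Fintype.sum_prod_type_right]
    refine Finset.sum_congr rfl fun j _ => ?_
    rw [Finset.sum_comm]

end Gram

/-! ### Decoding channels and quadratic forms -/

section Decoder

variable {b e : Type} [Fintype b] [DecidableEq b] [Fintype e] {M : ℕ}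

/-- A contraction `V : b → Fin M × e`, followed by discarding `e`, extends to a channel. -/
theorem exists_channel_of_contraction [NeZero M] {V : Matrix (Fin M × e) b ℂ}
    (hV : (1 - Vᴴ * V).PosSemidef) :
    ∃ D D' : Op b →ₗ[ℂ] Op (Fin M), IsCP D ∧ IsTP D ∧ IsCP D' ∧
      D = krausMap (fun x : e => Matrix.of fun i j => V (i, x) j) + D' := by
  obtain ⟨G, hG⟩ := CStarAlgebra.nonneg_iff_eq_star_mul_self.mp hV.nonneg
  let K : e ⊕ b → Matrix (Fin M) b ℂ := Sum.elim (fun x : e => Matrix.of fun i j => V (i, x) j)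
    (fun l => Matrix.of fun i j => if i = 0 then G l j else 0)
  refine ⟨krausMap K, krausMap fun l : b => Matrix.of fun i j => if i = 0 then G l j else 0,
    isCP_krausMap _, isTP_krausMap ?_, isCP_krausMap _, ?_⟩
  · rw [Fintype.sum_sum_type]
    have h1 : ∑ x : e, (K (Sum.inl x))ᴴ * K (Sum.inl x) = Vᴴ * V := by
      ext j j'
      simp only [K, Sum.elim_inl, Matrix.sum_apply, Matrix.mul_apply, Matrix.conjTranspose_apply,
        Matrix.of_apply, Fintype.sum_prod_type_right]
    have h2 : ∑ l : b, (K (Sum.inr l))ᴴ * K (Sum.inr l) = Gᴴ * G := by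
      ext j j'
      simp only [K, Sum.elim_inr, Matrix.sum_apply, Matrix.mul_apply, Matrix.conjTranspose_apply,
        Matrix.of_apply]
      refine Finset.sum_congr rfl fun l _ => ?_
      rw [Fintype.sum_eq_single 0 fun i hi => by simp [hi]]
      simp
    rw [h1, h2, ← Matrix.star_eq_conjTranspose G, ← hG]
    abel
  · simp [krausMap, K, Fintype.sum_sum_type]

end Decoder

section QuadraticForm

variable {m : Type} [Fintype m]

theorem star_dotProduct_mulVec_eq_trace (ψ : m → ℂ) (X : Op m) :
    star ψ ⬝ᵥ (X *ᵥ ψ) = (vecMulVec ψ (star ψ) * X).trace := by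
  rw [Matrix.vecMulVec_mul, Matrix.trace_vecMulVec, Matrix.dotProduct_mulVec, dotProduct_comm]

theorem one_sub_vecMulVec_posSemidef [DecidableEq m] {ψ : m → ℂ} (h : star ψ ⬝ᵥ ψ = 1) :
    (1 - vecMulVec ψ (star ψ)).PosSemidef := by
  set E := vecMulVec ψ (star ψ) with hE
  have h1 : E * E = E := by
    rw [hE, Matrix.vecMulVec_mul_vecMulVec, h, one_smul]
  have h2 : Eᴴ = E := (Matrix.posSemidef_vecMulVec_self_star ψ).1
  have h3 : 1 - E = (1 - E)ᴴ * (1 - E) := by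
    rw [Matrix.conjTranspose_sub, h2, Matrix.conjTranspose_one, Matrix.sub_mul,
      Matrix.mul_sub E, h1]
    simp
  rw [h3]
  exact Matrix.posSemidef_conjTranspose_mul_self _

theorem re_star_dotProduct_mulVec_nonneg (ψ : m → ℂ) {X : Op m} (hX : X.PosSemidef) :
    0 ≤ (star ψ ⬝ᵥ (X *ᵥ ψ)).re :=
  (Complex.nonneg_iff.1 (hX.dotProduct_mulVec_nonneg ψ)).1

theorem re_star_dotProduct_mulVec_le {ψ : m → ℂ} (h : star ψ ⬝ᵥ ψ = 1) {X : Op m}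
    (hX : X.PosSemidef) : (star ψ ⬝ᵥ (X *ᵥ ψ)).re ≤ X.trace.re := by
  classical
  rw [star_dotProduct_mulVec_eq_trace]
  exact re_trace_effect_mul_le (one_sub_vecMulVec_posSemidef h) hX

theorem re_trace_conjTranspose (X : Op m) : (Xᴴ).trace.re = X.trace.re := by
  rw [Matrix.trace_conjTranspose]; simp

/-- Expansion of `Tr (A + s) ω (A + s)ᴴ ≥ 0`. -/
theorem re_trace_quadratic_nonneg {ω : Op m} (hω : ω.PosSemidef) (A : Op m) (s : ℝ) :
    0 ≤ (A * ω * Aᴴ).trace.re + 2 * s * (A * ω).trace.re + s ^ 2 * ω.trace.re := by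
  classical
  have h := re_trace_nonneg (hω.mul_mul_conjTranspose_same (A + (s : ℂ) • (1 : Op m)))
  have h1 : (ω * Aᴴ).trace.re = (A * ω).trace.re := by
    rw [← re_trace_conjTranspose (A * ω), Matrix.conjTranspose_mul, hω.1]
  have h2 : (A + (s : ℂ) • (1 : Op m)) * ω * (A + (s : ℂ) • (1 : Op m))ᴴ
      = A * ω * Aᴴ + (s : ℂ) • (A * ω) + (s : ℂ) • (ω * Aᴴ) + ((s ^ 2 : ℝ) : ℂ) • ω := by
    simp only [Matrix.conjTranspose_add, Matrix.conjTranspose_smul, Matrix.conjTranspose_one,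
      Matrix.add_mul, Matrix.mul_add, Matrix.smul_mul, Matrix.mul_smul, Matrix.one_mul,
      Matrix.mul_one, Complex.star_def, Complex.conj_ofReal]
    push_cast
    module
  rw [h2] at h
  simp only [Matrix.trace_add, Matrix.trace_smul, Complex.add_re, smul_eq_mul,
    Complex.re_ofReal_mul, h1] at h
  linarith

/-- If the Kraus operators `N u` form a trace-nonincreasing map, then its value at the state `ω` is
bounded below by the overlap of the `N u` with the identity, in which `ω` may be replaced by `Q ω`
for an operator `Q` that acts on `ω` almost as the identity. -/
theorem sum_re_trace_ge [DecidableEq m] {Ω : Type} [Fintype Ω] [Nonempty Ω] {ω Q : Op m}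
    (hω : IsState ω) (hQ : Q.IsHermitian) (N : Ω → Op m)
    (hN : ∀ Y : Op m, Y.PosSemidef → ∑ u, (N u * Y * (N u)ᴴ).trace.re ≤ Y.trace.re)
    {δ κ : ℝ} (hδ : ((1 - Q) * (1 - Q) * ω).trace.re ≤ δ) (hκ : 0 < κ) :
    2 * ((√(Fintype.card Ω : ℝ))⁻¹ * ∑ u, (N u * (Q * ω)).trace.re) - κ * δ - κ⁻¹ - 1
      ≤ ∑ u, (N u * ω * (N u)ᴴ).trace.re := by
  set s : ℝ := (√(Fintype.card Ω : ℝ))⁻¹ with hs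
  have hcard : (0 : ℝ) < Fintype.card Ω := by exact_mod_cast Fintype.card_pos
  have hs2 : (Fintype.card Ω : ℝ) * s ^ 2 = 1 := by
    rw [hs, inv_pow, Real.sq_sqrt hcard.le, mul_inv_cancel₀ hcard.ne']
  have htr : ω.trace.re = 1 := by rw [hω.2]; rfl
  -- The quadratic form of `N u - s` at `ω`; the choice of `s` makes the terms `s ^ 2` sum to `1`.
  have h1 : ∀ u, 0 ≤ (N u * ω * (N u)ᴴ).trace.re - 2 * s * (N u * ω).trace.re + s ^ 2 := by
    intro u
    have := re_trace_quadratic_nonneg hω.1 (N u) (-s)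
    rw [htr] at this
    linarith
  have hC : (1 - Q)ᴴ = 1 - Q := by
    rw [Matrix.conjTranspose_sub, hQ, Matrix.conjTranspose_one]
  -- The cross term with `(1 - Q) ω`, by Young's inequality with weight `κ`.
  have h2 : ∀ u, 0 ≤ κ * (N u * ((1 - Q) * ω * (1 - Q)) * (N u)ᴴ).trace.re
      + 2 * s * (N u * ((1 - Q) * ω)).trace.re + κ⁻¹ * s ^ 2 := by
    intro u
    have := re_trace_quadratic_nonneg hω.1 ((κ : ℂ) • (N u * (1 - Q))) s
    have e1 : ((κ : ℂ) • (N u * (1 - Q))) * ω * ((κ : ℂ) • (N u * (1 - Q)))ᴴ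
        = ((κ ^ 2 : ℝ) : ℂ) • (N u * ((1 - Q) * ω * (1 - Q)) * (N u)ᴴ) := by
      simp only [Matrix.conjTranspose_smul, Matrix.conjTranspose_mul, hC, Matrix.smul_mul,
        Matrix.mul_smul, smul_smul, Matrix.mul_assoc, Complex.star_def, Complex.conj_ofReal]
      push_cast
      rw [sq]
    rw [e1, htr, Matrix.smul_mul, Matrix.trace_smul, Matrix.trace_smul, smul_eq_mul, smul_eq_mul,
      Complex.re_ofReal_mul, Complex.re_ofReal_mul, Matrix.mul_assoc (N u) (1 - Q) ω] at this
    have h3 := mul_nonneg (inv_nonneg.2 hκ.le) this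
    have h4 : κ⁻¹ * κ = 1 := inv_mul_cancel₀ hκ.ne'
    calc (0 : ℝ) ≤ _ := h3
      _ = (κ⁻¹ * κ) * κ * (N u * ((1 - Q) * ω * (1 - Q)) * (N u)ᴴ).trace.re
        + (κ⁻¹ * κ) * (2 * s * (N u * ((1 - Q) * ω)).trace.re) + κ⁻¹ * s ^ 2 := by ring
      _ = _ := by rw [h4]; ring
  have h3 : ∀ u, (N u * ω).trace.re
      = (N u * (Q * ω)).trace.re + (N u * ((1 - Q) * ω)).trace.re := by
    intro u
    rw [← Complex.add_re, ← Matrix.trace_add, ← Matrix.mul_add, ← Matrix.add_mul,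
      add_sub_cancel, Matrix.one_mul]
  have h4 : ∑ u, (N u * ((1 - Q) * ω * (1 - Q)) * (N u)ᴴ).trace.re ≤ δ := by
    refine (hN _ ?_).trans ?_
    · have := hω.1.mul_mul_conjTranspose_same (1 - Q)
      rwa [hC] at this
    · rwa [Matrix.trace_mul_cycle]
  have h5 := Finset.sum_nonneg fun u (_ : u ∈ Finset.univ) => add_nonneg (h1 u) (h2 u)
  simp only [h3] at h5
  simp only [Finset.sum_add_distrib, Finset.sum_sub_distrib, ← Finset.mul_sum, Finset.sum_const,
    Finset.card_univ, nsmul_eq_mul] at h5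
  rw [hs2] at h5
  linarith [mul_le_mul_of_nonneg_left h4 hκ.le]

end QuadraticForm

/-! ### The overlap achieved by the decoders -/

section OneShot

variable {a b : Type} [Fintype a] [Fintype b]

/-- The maximally entangled vector `M ^ (-1/2) * ∑ i, |i⟩ ⊗ |i⟩`. -/
def mesVec (M : ℕ) : Fin M × Fin M → ℂ :=
  fun p => if p.1 = p.2 then ((√(M : ℝ))⁻¹ : ℝ) else 0

theorem star_mesVec (M : ℕ) : star (mesVec M) = mesVec M := by
  ext p
  simp only [Pi.star_apply, mesVec]
  split_ifs <;> simp

theorem star_mesVec_dotProduct_self (M : ℕ) [NeZero M] : star (mesVec M) ⬝ᵥ mesVec M = 1 := by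
  have hM : (0 : ℝ) < M := by exact_mod_cast Nat.pos_of_ne_zero (NeZero.ne M)
  rw [star_mesVec]
  simp only [dotProduct, mesVec, Fintype.sum_prod_type, mul_ite, ite_mul, zero_mul, mul_zero]
  simp only [Finset.sum_ite_eq, Finset.mem_univ, if_true, Finset.sum_const, Finset.card_univ,
    Fintype.card_fin, nsmul_eq_mul]
  rw [← Complex.ofReal_mul, ← mul_inv, Real.mul_self_sqrt hM.le]
  push_cast
  exact mul_inv_cancel₀ (by exact_mod_cast hM.ne')

/-- If Alice applies the Kraus operator `A`, and Bob the Kraus operators `V x` obtained from `V` by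
discarding `e`, then the overlap with the maximally entangled vector is `Tr N Y Nᴴ`, where the rows
of `N` are the functionals `⟨mesVec M| (A ⊗ V x)`. -/
theorem mesVec_form_decoded {e : Type} [Fintype e] {M : ℕ} (A : Matrix (Fin M) a ℂ)
    (V : Matrix (Fin M × e) b ℂ) (N : Matrix e (a × b) ℂ)
    (hN : ∀ x p, N x p = ∑ i, ((√(M : ℝ))⁻¹ : ℝ) * A i p.1 * V (i, x) p.2) (Y : Op (a × b)) :
    star (mesVec M) ⬝ᵥ (onRight (Fin M) (krausMap fun x : e => Matrix.of fun i j => V (i, x) j)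
      (onLeft b (conjMap A) Y) *ᵥ mesVec M) = (N * Y * Nᴴ).trace := by
  classical
  rw [krausMap, onRight_sum, Matrix.sum_mulVec, dotProduct_sum]
  refine Finset.sum_congr rfl fun x _ => ?_
  rw [onRight_conjMap, onLeft_conjMap]
  set L : Matrix (Fin M × Fin M) (a × b) ℂ :=
    ((1 : Op (Fin M)) ⊗ₖ (Matrix.of fun i j => V (i, x) j)) * (A ⊗ₖ (1 : Op b)) with hL
  have h1 : star (mesVec M) ᵥ* L = N x := by
    ext p
    rw [hL, ← Matrix.mul_kronecker_mul, Matrix.one_mul, Matrix.mul_one, star_mesVec, hN]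
    simp only [Matrix.vecMul, dotProduct, mesVec, Fintype.sum_prod_type, ite_mul, zero_mul,
      Finset.sum_ite_eq, Finset.mem_univ, if_true, Matrix.kroneckerMap_apply, Matrix.of_apply,
      mul_assoc]
  have h2 : ((1 : Op (Fin M)) ⊗ₖ (Matrix.of fun i j => V (i, x) j))
      * ((A ⊗ₖ (1 : Op b)) * Y * (A ⊗ₖ (1 : Op b))ᴴ)
      * ((1 : Op (Fin M)) ⊗ₖ (Matrix.of fun i j => V (i, x) j))ᴴ = L * Y * Lᴴ := by
    rw [hL, Matrix.conjTranspose_mul]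
    simp only [Matrix.mul_assoc]
  have h3 : Lᴴ *ᵥ mesVec M = star (N x) := by
    rw [← h1, Matrix.star_vecMul, star_star]
  rw [h2, ← Matrix.mulVec_mulVec, ← Matrix.mulVec_mulVec, h3, Matrix.dotProduct_mulVec, h1,
    Matrix.dotProduct_mulVec]
  simp only [Matrix.diag, Matrix.mul_apply, dotProduct, Matrix.vecMul, Matrix.conjTranspose_apply,
    Pi.star_apply]

theorem partialTrace_mul_codeMatrix {a b : Type} [Fintype b] [DecidableEq b] {M : ℕ}
    (u : Fin M × a → ZMod 3) (V : Matrix (Fin M × (a × b)) b ℂ) (x p : a × b) :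
    partialTrace (V * (codeMatrix b u)ᴴ) x p
      = ∑ i, star (phase u (i, p.1)) * V (i, x) p.2 := by
  simp only [partialTrace, Matrix.of_apply, Matrix.mul_apply, Matrix.conjTranspose_apply,
    codeMatrix]
  refine Finset.sum_congr rfl fun i _ => ?_
  rw [Fintype.sum_eq_single p.2 fun j hj => by simp [Ne.symm hj]]
  simp [mul_comm]

theorem one_kronecker_posSemidef {m : Type} [Fintype m] [DecidableEq m] {X : Op b}
    (hX : X.PosSemidef) : ((1 : Op m) ⊗ₖ X).PosSemidef :=
  Matrix.PosSemidef.one.kronecker hX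

/-- The overlap achieved by a decoder `V` for the matrix `W = (1 ⊗ Q) * codeMatrix b u`, with the
property of `exists_contraction_mul_ge`. The traces of `W Wᴴ` and `(W Wᴴ)²` against `1 ⊗ ω` are
expressed by `codeGram`. -/
theorem re_trace_decoder_ge [DecidableEq a] [DecidableEq b] {M : ℕ} (u : Fin M × a → ZMod 3)
    {ω P Q : Op (a × b)} (hω : ω.PosSemidef) (hQ : Q.IsHermitian) (hQP : Q * Q = P)
    {V : Matrix (Fin M × (a × b)) b ℂ}
    (hV : (V * (((1 : Op (Fin M)) ⊗ₖ Q) * codeMatrix b u)ᴴ - (2⁻¹ : ℂ) • ((3 : ℂ) •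
      ((((1 : Op (Fin M)) ⊗ₖ Q) * codeMatrix b u) * (((1 : Op (Fin M)) ⊗ₖ Q) * codeMatrix b u)ᴴ)
      - ((((1 : Op (Fin M)) ⊗ₖ Q) * codeMatrix b u) * (((1 : Op (Fin M)) ⊗ₖ Q) * codeMatrix b u)ᴴ)
      * ((((1 : Op (Fin M)) ⊗ₖ Q) * codeMatrix b u)
        * (((1 : Op (Fin M)) ⊗ₖ Q) * codeMatrix b u)ᴴ))).PosSemidef) :
    2⁻¹ * (3 * (codeGram u (Q * ω * Q)).trace.re
        - (codeGram u (Q * ω * Q) * codeGram u P).trace.re)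
      ≤ (partialTrace (V * (codeMatrix b u)ᴴ) * (Q * ω)).trace.re := by
  set Z := codeMatrix b u with hZ
  set Q₁ : Op (Fin M × (a × b)) := (1 : Op (Fin M)) ⊗ₖ Q with hQ₁
  set ω₁ : Op (Fin M × (a × b)) := (1 : Op (Fin M)) ⊗ₖ ω with hω₁
  have hQ₁h : Q₁ᴴ = Q₁ := by
    rw [hQ₁, Matrix.conjTranspose_kronecker, hQ, Matrix.conjTranspose_one]
  have hQ₁P : Q₁ * Q₁ = (1 : Op (Fin M)) ⊗ₖ P := by
    rw [hQ₁, ← Matrix.mul_kronecker_mul, hQP, Matrix.one_mul]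
  have hQ₁ω : Q₁ * ω₁ * Q₁ = (1 : Op (Fin M)) ⊗ₖ (Q * ω * Q) := by
    rw [hQ₁, hω₁, ← Matrix.mul_kronecker_mul, ← Matrix.mul_kronecker_mul, Matrix.one_mul,
      Matrix.one_mul]
  have h := re_trace_mul_nonneg hV (one_kronecker_posSemidef (m := Fin M) hω)
  rw [← hω₁] at h
  have e1 : (V * (Q₁ * Z)ᴴ * ω₁).trace = (partialTrace (V * Zᴴ) * (Q * ω)).trace := by
    rw [← trace_mul_one_kronecker, Matrix.conjTranspose_mul, hQ₁h]
    have : (1 : Op (Fin M)) ⊗ₖ (Q * ω) = Q₁ * ω₁ := by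
      rw [hQ₁, hω₁, ← Matrix.mul_kronecker_mul, Matrix.one_mul]
    rw [this]
    simp only [Matrix.mul_assoc]
  have e2 : ((Q₁ * Z) * (Q₁ * Z)ᴴ * ω₁).trace = (codeGram u (Q * ω * Q)).trace := by
    rw [codeGram, ← hQ₁ω, ← hZ, Matrix.conjTranspose_mul, hQ₁h]
    calc (Q₁ * Z * (Zᴴ * Q₁) * ω₁).trace = ((Q₁ * Z) * (Zᴴ * Q₁ * ω₁)).trace := by
          simp only [Matrix.mul_assoc]
      _ = ((Zᴴ * Q₁ * ω₁) * (Q₁ * Z)).trace := Matrix.trace_mul_comm _ _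
      _ = _ := by simp only [Matrix.mul_assoc]
  have e3 : (((Q₁ * Z) * (Q₁ * Z)ᴴ) * ((Q₁ * Z) * (Q₁ * Z)ᴴ) * ω₁).trace
      = (codeGram u (Q * ω * Q) * codeGram u P).trace := by
    rw [codeGram, codeGram, ← hQ₁ω, ← hQ₁P, ← hZ, Matrix.conjTranspose_mul, hQ₁h]
    calc (Q₁ * Z * (Zᴴ * Q₁) * (Q₁ * Z * (Zᴴ * Q₁)) * ω₁).trace
        = ((Q₁ * Z * Zᴴ * Q₁ * Q₁ * Z) * (Zᴴ * Q₁ * ω₁)).trace := by simp only [Matrix.mul_assoc]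
      _ = ((Zᴴ * Q₁ * ω₁) * (Q₁ * Z * Zᴴ * Q₁ * Q₁ * Z)).trace := Matrix.trace_mul_comm _ _
      _ = _ := by simp only [Matrix.mul_assoc]
  rw [Matrix.sub_mul, Matrix.trace_sub, Matrix.smul_mul, Matrix.sub_mul, Matrix.smul_mul,
    Matrix.trace_smul, Matrix.trace_sub, Matrix.trace_smul, e1, e2, e3] at h
  have h2 : ((2⁻¹ : ℂ) • ((3 : ℂ) • (codeGram u (Q * ω * Q)).trace
      - (codeGram u (Q * ω * Q) * codeGram u P).trace)).re
      = 2⁻¹ * (3 * (codeGram u (Q * ω * Q)).trace.re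
        - (codeGram u (Q * ω * Q) * codeGram u P).trace.re) := by
    rw [smul_eq_mul, smul_eq_mul,
      show (2⁻¹ : ℂ) = ((2⁻¹ : ℝ) : ℂ) by push_cast; rfl, Complex.re_ofReal_mul, Complex.sub_re,
      show (3 : ℂ) = ((3 : ℝ) : ℂ) by push_cast; rfl, Complex.re_ofReal_mul]
  rw [Complex.sub_re, h2] at h
  linarith

/-- The moments of the code: the average overlap is at least `Tr P ω (1 - M lam / 2)`. -/
theorem sum_codeGram_ge [DecidableEq a] [DecidableEq b] {M : ℕ}
    {ω P Q : Op (a × b)} (hω : ω.PosSemidef) (hP : P.PosSemidef) (hP1 : (1 - P).PosSemidef)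
    (hQ : Q.IsHermitian) (hQP : Q * Q = P) {lam : ℝ}
    (hlam : ((lam : ℂ) • (1 : Op b) - partialTrace P).PosSemidef) :
    (Fintype.card (Fin M × a → ZMod 3) : ℝ) * M * ((P * ω).trace.re * (1 - M * lam / 2))
      ≤ ∑ u : Fin M × a → ZMod 3, 2⁻¹ * (3 * (codeGram u (Q * ω * Q)).trace.re
        - (codeGram u (Q * ω * Q) * codeGram u P).trace.re) := by
  set n : ℝ := (Fintype.card (Fin M × a → ZMod 3) : ℝ) with hn
  set X : Op (a × b) := Q * ω * Q with hX
  have hXp : X.PosSemidef := by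
    have := hω.mul_mul_conjTranspose_same Q
    rwa [hQ] at this
  have htX : X.trace = (P * ω).trace := by
    rw [hX, Matrix.trace_mul_cycle, hQP]
  have c1 : ((Fintype.card (Fin M × a → ZMod 3) : ℂ) * M) = ((n * M : ℝ) : ℂ) := by
    rw [hn]; push_cast; rfl
  have h1 : ∑ u : Fin M × a → ZMod 3, (codeGram u X).trace.re = n * M * (P * ω).trace.re := by
    have := congrArg Complex.re (sum_trace_codeGram (M := M) X)
    rwa [Complex.re_sum, htX, c1, Complex.re_ofReal_mul] at this
  have h2 : ∑ u : Fin M × a → ZMod 3, (codeGram u X * codeGram u P).trace.re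
      ≤ n * M ^ 2 * (partialTrace X * partialTrace P).trace.re + n * M * (X * P).trace.re := by
    have h := congrArg Complex.re (sum_trace_codeGram_mul (M := M) X P)
    have hpos : 0 ≤ (∑ k, (X.submatrix (Prod.mk k) (Prod.mk k)
        * P.submatrix (Prod.mk k) (Prod.mk k)).trace).re := by
      rw [Complex.re_sum]
      exact Finset.sum_nonneg fun k _ =>
        re_trace_mul_nonneg (hXp.submatrix _) (hP.submatrix _)
    have c2 : ((Fintype.card (Fin M × a → ZMod 3) : ℂ) * M ^ 2) = ((n * M ^ 2 : ℝ) : ℂ) := by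
      rw [hn]; push_cast; rfl
    rw [c1, c2] at h
    simp only [Complex.add_re, Complex.re_ofReal_mul] at h
    rw [Complex.re_sum] at h
    have : 0 ≤ n * M := by positivity
    nlinarith [mul_nonneg this hpos]
  have h3 : (partialTrace X * partialTrace P).trace.re ≤ lam * (P * ω).trace.re := by
    have := re_trace_mul_nonneg hlam (partialTrace_posSemidef hXp)
    rw [Matrix.sub_mul, Matrix.trace_sub, Matrix.smul_mul, Matrix.one_mul, Matrix.trace_smul,
      trace_partialTrace, htX, Complex.sub_re, smul_eq_mul, Complex.re_ofReal_mul,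
      Matrix.trace_mul_comm (partialTrace P)] at this
    linarith
  have h4 : (X * P).trace.re ≤ (P * ω).trace.re := by
    have := re_trace_effect_mul_le hP1 hXp
    rw [htX, Matrix.trace_mul_comm] at this
    exact this
  rw [← Finset.mul_sum, Finset.sum_sub_distrib, ← Finset.mul_sum, h1]
  have h5 : n * M ^ 2 * (partialTrace X * partialTrace P).trace.re
      ≤ n * M ^ 2 * (lam * (P * ω).trace.re) := by gcongr
  have h6 : n * M * (X * P).trace.re ≤ n * M * (P * ω).trace.re := by gcongr
  nlinarith

end OneShot

/-! ### One-shot distillation -/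

section OneShotTheorem

variable {a b : Type} [Fintype a] [Fintype b]

/-- One-shot distillation with a random code: if a test `P` accepts `ω` with probability `t`, and
the partial trace of `P` is at most `lam`, then about `1 / lam` dimensions of maximal entanglement
can be distilled from `ω` with forward communication. The parameter `κ` weighs the error made in
replacing `ω` by `√P ω`. -/
theorem exists_oneWayLOCC_of_effect [DecidableEq a] [DecidableEq b] {M : ℕ} [NeZero M]
    {ω P : Op (a × b)} (hω : IsState ω) (hP : P.PosSemidef) (hP1 : (1 - P).PosSemidef)
    {lam κ : ℝ} (hlam : ((lam : ℂ) • (1 : Op b) - partialTrace P).PosSemidef) (hκ : 0 < κ) :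
    ∃ Λ : Op (a × b) →ₗ[ℂ] Op (Fin M × Fin M), IsOneWayLOCC Λ ∧
      2 * ((P * ω).trace.re * (1 - M * lam / 2)) - κ * (1 - (P * ω).trace.re) - κ⁻¹ - 1
        ≤ (star (mesVec M) ⬝ᵥ (Λ ω *ᵥ mesVec M)).re := by
  obtain ⟨Q, hQp, hQP, hQ1⟩ := exists_sqrt_of_effect hP hP1
  have hQ : Q.IsHermitian := hQp.1
  have hM : (0 : ℝ) < M := by exact_mod_cast Nat.pos_of_ne_zero (NeZero.ne M)
  set n : ℝ := (Fintype.card (Fin M × a → ZMod 3) : ℝ) with hn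
  have hn0 : 0 < n := by rw [hn]; exact_mod_cast Fintype.card_pos
  choose V hV1 hV2 using fun u : Fin M × a → ZMod 3 =>
    exists_contraction_mul_ge (((1 : Op (Fin M)) ⊗ₖ Q) * codeMatrix b u)
  choose D D' hD hDT hD' hDD using fun u => exists_channel_of_contraction (hV1 u)
  -- Alice announces the code `u`. Summed over the `n` codes, the Gram matrices of the unnormalised
  -- Kraus operators `∑ i, |i⟩⟨z i|` give `M * n` times the identity.
  let A : (Fin M × a → ZMod 3) → Matrix (Fin M) a ℂ := fun u =>
    Matrix.of fun i k => ((√(M * n))⁻¹ : ℝ) * star (phase u (i, k))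
  let N : (Fin M × a → ZMod 3) → Op (a × b) := fun u =>
    (((√ (M : ℝ))⁻¹ * (√(M * n))⁻¹ : ℝ) : ℂ) • partialTrace (V u * (codeMatrix b u)ᴴ)
  have hN : ∀ u x p, N u x p = ∑ i, ((√(M : ℝ))⁻¹ : ℝ) * A u i p.1 * V u (i, x) p.2 := by
    intro u x p
    simp only [N, A, Matrix.smul_apply, partialTrace_mul_codeMatrix, smul_eq_mul, Finset.mul_sum,
      Matrix.of_apply]
    refine Finset.sum_congr rfl fun i _ => ?_
    push_cast
    ring
  have hA : IsTP (∑ u, conjMap (A u)) := by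
    refine isTP_krausMap (K := A) ?_
    ext k k'
    have h1 : ∀ u i, star (A u i k) * A u i k'
        = (((M * n)⁻¹ : ℝ) : ℂ) * (star (phase u (i, k')) * phase u (i, k)) := by
      intro u i
      have : ((√(M * n))⁻¹ : ℝ) * ((√(M * n))⁻¹ : ℝ) = (M * n)⁻¹ := by
        rw [← mul_inv, Real.mul_self_sqrt (by positivity)]
      rw [← this]
      simp only [A, Matrix.of_apply, star_mul, star_star]
      simp only [Complex.star_def, Complex.conj_ofReal]
      push_cast
      ring
    simp only [Matrix.sum_apply, Matrix.mul_apply, Matrix.conjTranspose_apply, h1,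
      ← Finset.mul_sum]
    rw [Finset.sum_comm]
    simp only [sum_phase_two, Prod.mk.injEq, true_and, Finset.sum_const,
      Finset.card_univ, Fintype.card_fin, nsmul_eq_mul, Matrix.one_apply]
    rcases eq_or_ne k k' with h | h
    · subst h
      have : ((M : ℂ) * (Fintype.card (Fin M × a → ZMod 3) : ℂ)) = ((M * n : ℝ) : ℂ) := by
        rw [hn]; push_cast; rfl
      rw [if_pos rfl, if_pos rfl, this, ← Complex.ofReal_mul,
        inv_mul_cancel₀ (by positivity)]
      rfl
    · rw [if_neg h.symm, if_neg h]
      simp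
  refine ⟨∑ u, onRight (Fin M) (D u) ∘ₗ onLeft b (conjMap (A u)),
    isOneWayLOCC_sum _ _ (fun u => isCP_conjMap _) hA fun u => ⟨hD u, hDT u⟩, ?_⟩
  set Λ : Op (a × b) →ₗ[ℂ] Op (Fin M × Fin M) :=
    ∑ u, onRight (Fin M) (D u) ∘ₗ onLeft b (conjMap (A u)) with hΛ
  have hΛ1 : IsOneWayLOCC Λ :=
    isOneWayLOCC_sum _ _ (fun u => isCP_conjMap _) hA fun u => ⟨hD u, hDT u⟩
  have hform : ∀ Y : Op (a × b), Y.PosSemidef →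
      ∑ u, (N u * Y * (N u)ᴴ).trace.re ≤ (star (mesVec M) ⬝ᵥ (Λ Y *ᵥ mesVec M)).re := by
    intro Y hY
    rw [hΛ, LinearMap.sum_apply, Matrix.sum_mulVec, dotProduct_sum, Complex.re_sum]
    refine Finset.sum_le_sum fun u _ => ?_
    rw [LinearMap.comp_apply, hDD u, onRight_add, Matrix.add_mulVec, dotProduct_add,
      mesVec_form_decoded (A u) (V u) (N u) (hN u), Complex.add_re]
    have := re_star_dotProduct_mulVec_nonneg (mesVec M)
      ((hD' u).onRight_posSemidef ((isCP_conjMap (A u)).onLeft_posSemidef hY))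
    linarith
  -- The `N u` are trace-nonincreasing, since they compute an overlap with the output of a channel.
  have hN1 : ∀ Y : Op (a × b), Y.PosSemidef → ∑ u, (N u * Y * (N u)ᴴ).trace.re ≤ Y.trace.re := by
    intro Y hY
    refine (hform Y hY).trans ?_
    rw [← hΛ1.posSemidef_and_isTP.2 Y]
    exact re_star_dotProduct_mulVec_le (star_mesVec_dotProduct_self M)
      (hΛ1.posSemidef_and_isTP.1 Y hY)
  have hδ : ((1 - Q) * (1 - Q) * ω).trace.re ≤ 1 - (P * ω).trace.re := by
    have h := re_trace_mul_le hQ1 hω.1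
    rw [Matrix.sub_mul 1 P, Matrix.one_mul, Matrix.trace_sub, Complex.sub_re, hω.2] at h
    exact h
  refine le_trans ?_ (hform ω hω.1)
  refine le_trans ?_ (sum_re_trace_ge hω hQ N hN1 hδ hκ)
  have hmom := (sum_codeGram_ge (M := M) hω.1 hP hP1 hQ hQP hlam).trans
    (Finset.sum_le_sum fun u _ => re_trace_decoder_ge u hω.1 hQ hQP (hV2 u))
  have hsum : (√(Fintype.card (Fin M × a → ZMod 3) : ℝ))⁻¹ * ∑ u, (N u * (Q * ω)).trace.re
      = (n * M)⁻¹ * ∑ u, (partialTrace (V u * (codeMatrix b u)ᴴ) * (Q * ω)).trace.re := by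
    have e : ∀ u, (N u * (Q * ω)).trace.re = ((√ (M : ℝ))⁻¹ * (√(M * n))⁻¹)
        * (partialTrace (V u * (codeMatrix b u)ᴴ) * (Q * ω)).trace.re := by
      intro u
      rw [Matrix.smul_mul, Matrix.trace_smul, smul_eq_mul, Complex.re_ofReal_mul]
    simp only [e, ← Finset.mul_sum]
    rw [← mul_assoc, ← hn, Real.sqrt_mul hM.le]
    congr 1
    have s1 := Real.mul_self_sqrt hM.le
    have s2 := Real.mul_self_sqrt hn0.le
    have : (√n)⁻¹ * ((√(M : ℝ))⁻¹ * (√(M : ℝ) * √n)⁻¹) = ((√n * √n) * (√(M : ℝ) * √(M : ℝ)))⁻¹ := by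
      simp only [mul_inv]
      ring
    rw [this, s1, s2]
  rw [hsum]
  have h7 : (P * ω).trace.re * (1 - M * lam / 2)
      ≤ (n * M)⁻¹ * ∑ u, (partialTrace (V u * (codeMatrix b u)ᴴ) * (Q * ω)).trace.re := by
    rw [inv_mul_eq_div, le_div_iff₀ (by positivity)]
    linarith
  linarith

end OneShotTheorem

/-! ### The minimax theorem for tests -/

section Minimax

variable {a b : Type} [Fintype a] [Fintype b] [DecidableEq a] [DecidableEq b]

theorem isClosed_posSemidef {m : Type} [Fintype m] : IsClosed {X : Op m | X.PosSemidef} := by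
  have : {X : Op m | X.PosSemidef} = {X | Xᴴ = X} ∩ ⋂ v : m → ℂ, {X | 0 ≤ star v ⬝ᵥ (X *ᵥ v)} := by
    ext X
    simp [Matrix.posSemidef_iff_dotProduct_mulVec, Matrix.IsHermitian]
  rw [this]
  refine (isClosed_eq (by fun_prop) continuous_id).inter (isClosed_iInter fun v => ?_)
  refine isClosed_le continuous_const ?_
  exact continuous_const.dotProduct (continuous_id.matrix_mulVec continuous_const)

open scoped Matrix.Norms.L2Operator in
theorem isCompact_effects {m : Type} [Fintype m] [DecidableEq m] :
    IsCompact {X : Op m | X.PosSemidef ∧ (1 - X).PosSemidef} := by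
  have : ProperSpace (Op m) := FiniteDimensional.proper ℂ (Op m)
  refine Metric.isCompact_of_isClosed_isBounded ?_ ?_
  · exact isClosed_posSemidef.inter (isClosed_posSemidef.preimage (by fun_prop))
  · refine (Metric.isBounded_closedBall (x := (0 : Op m)) (r := 1)).subset ?_
    rintro X ⟨h0, h1⟩
    rw [mem_closedBall_zero_iff]
    exact (CStarAlgebra.norm_le_one_iff_of_nonneg X h0.nonneg).2 h1

theorem IsState.one_sub_posSemidef {m : Type} [Fintype m] [DecidableEq m] {ρ : Op m}
    (hρ : IsState ρ) : (1 - ρ).PosSemidef := by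
  have h : ρ ≤ algebraMap ℝ (Op m) 1 := by
    have hsa : IsSelfAdjoint ρ := hρ.1.1
    rw [le_algebraMap_iff_spectrum_le]
    intro x hx
    rw [hρ.1.1.spectrum_real_eq_range_eigenvalues] at hx
    obtain ⟨i, rfl⟩ := hx
    have h1 : ∑ j, hρ.1.1.eigenvalues j = 1 := by
      have h2 : ((∑ j, hρ.1.1.eigenvalues j : ℝ) : ℂ) = 1 := by
        rw [Complex.ofReal_sum]
        exact hρ.1.1.trace_eq_sum_eigenvalues.symm.trans hρ.2
      exact_mod_cast h2
    rw [← h1]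
    exact Finset.single_le_sum (fun j _ => hρ.1.eigenvalues_nonneg j) (Finset.mem_univ i)
  rw [map_one] at h
  exact h

theorem isCompact_states {m : Type} [Fintype m] [DecidableEq m] :
    IsCompact {X : Op m | IsState X} := by
  refine isCompact_effects.of_isClosed_subset ?_ fun X hX => ⟨hX.1, hX.one_sub_posSemidef⟩
  exact isClosed_posSemidef.inter (isClosed_eq (by fun_prop) continuous_const)

theorem convex_effects {m : Type} [Fintype m] [DecidableEq m] :
    Convex ℝ {X : Op m | X.PosSemidef ∧ (1 - X).PosSemidef} := by
  rintro X ⟨hX, hX1⟩ Y ⟨hY, hY1⟩ r t hr ht hrt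
  refine ⟨(hX.smul hr).add (hY.smul ht), ?_⟩
  have : 1 - (r • X + t • Y) = r • (1 - X) + t • (1 - Y) := by
    have h1 : (1 : Op m) = r • (1 : Op m) + t • (1 : Op m) := by rw [← add_smul, hrt, one_smul]
    conv_lhs => rw [h1]
    module
  rw [this]
  exact (hX1.smul hr).add (hY1.smul ht)

theorem convex_states {m : Type} [Fintype m] : Convex ℝ {X : Op m | IsState X} := by
  rintro X ⟨hX, hX1⟩ Y ⟨hY, hY1⟩ r t hr ht hrt
  refine ⟨(hX.smul hr).add (hY.smul ht), ?_⟩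
  rw [Matrix.trace_add, Matrix.trace_smul, Matrix.trace_smul, hX1, hY1, ← add_smul, hrt, one_smul]

/-- The normalised projector onto a nonzero vector. -/
theorem isState_vecMulVec {m : Type} [Fintype m] {v : m → ℂ} {t : ℝ} (ht : 0 < t)
    (hv : star v ⬝ᵥ v = t) : IsState (((t⁻¹ : ℝ) : ℂ) • vecMulVec v (star v)) := by
  refine ⟨(Matrix.posSemidef_vecMulVec_self_star v).smul ?_, ?_⟩
  · exact Complex.zero_le_real.2 (inv_nonneg.2 ht.le)
  · rw [Matrix.trace_smul, Matrix.trace_vecMulVec, dotProduct_comm, hv, smul_eq_mul,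
      ← Complex.ofReal_mul, inv_mul_cancel₀ ht.ne', Complex.ofReal_one]

theorem exists_isState (m : Type) [Fintype m] [Nonempty m] : ∃ X : Op m, IsState X := by
  classical
  refine ⟨_, isState_vecMulVec (v := Pi.single (Classical.arbitrary m) 1) one_pos ?_⟩
  simp

/-- By the minimax theorem, tests that work against every state `τ` can be replaced by a single
test, whose partial trace is then small. -/
theorem exists_effect_of_forall_state [Nonempty b] {ω : Op (a × b)} {c δ : ℝ}
    (h : ∀ τ : Op b, IsState τ → ∃ P : Op (a × b), P.PosSemidef ∧ (1 - P).PosSemidef ∧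
      1 - δ ≤ (P * (ω - (c : ℂ) • ((1 : Op a) ⊗ₖ τ))).trace.re) (hω : IsState ω) (hc : 0 ≤ c) :
    ∃ P : Op (a × b), P.PosSemidef ∧ (1 - P).PosSemidef ∧ 1 - δ ≤ (P * ω).trace.re ∧
      ((δ : ℂ) • (1 : Op b) - (c : ℂ) • partialTrace P).PosSemidef := by
  set f : Op b → Op (a × b) → ℝ := fun τ P =>
    (P * (ω - (c : ℂ) • ((1 : Op a) ⊗ₖ τ))).trace.re with hf
  have hf' : ∀ τ P, f τ P = (P * ω).trace.re - c * (partialTrace P * τ).trace.re := by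
    intro τ P
    simp only [hf, Matrix.mul_sub, Matrix.trace_sub, Complex.sub_re, Matrix.mul_smul,
      Matrix.trace_smul, smul_eq_mul, Complex.re_ofReal_mul, trace_mul_one_kronecker]
  have hcont1 : ∀ P, Continuous fun τ => f τ P := by
    intro P
    simp only [hf']
    fun_prop
  have hcont2 : ∀ τ, Continuous fun P => f τ P := by
    intro τ
    simp only [hf]
    fun_prop
  obtain ⟨τ₀, hτ₀, P₀, hP₀, hsad⟩ : ∃ τ ∈ {X : Op b | IsState X},
      ∃ P ∈ {X : Op (a × b) | X.PosSemidef ∧ (1 - X).PosSemidef},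
      IsSaddlePointOn {X : Op b | IsState X}
        {X : Op (a × b) | X.PosSemidef ∧ (1 - X).PosSemidef} f τ P := by
    refine Sion.exists_isSaddlePointOn (exists_isState b) convex_states isCompact_states
      (fun P _ => (hcont1 P).lowerSemicontinuous.lowerSemicontinuousOn _)
      (fun P _ => ConvexOn.quasiconvexOn ⟨convex_states, fun x _ y _ r t _ _ hrt => le_of_eq ?_⟩)
      convex_effects
      ⟨0, Matrix.PosSemidef.zero, by simpa using Matrix.PosSemidef.one⟩ isCompact_effects
      (fun τ _ => (hcont2 τ).upperSemicontinuous.upperSemicontinuousOn _)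
      (fun τ _ => ConcaveOn.quasiconcaveOn ⟨convex_effects, fun x _ y _ r t _ _ _ => le_of_eq ?_⟩)
    · simp only [hf', Matrix.mul_add, Matrix.mul_smul, Matrix.trace_add, Matrix.trace_smul,
        Complex.add_re, Complex.smul_re, smul_eq_mul]
      linear_combination (-(P * ω).trace.re) * hrt
    · simp only [hf, Matrix.add_mul, Matrix.smul_mul, Matrix.trace_add, Matrix.trace_smul,
        Complex.add_re, Complex.smul_re, smul_eq_mul]
  obtain ⟨P₁, hP₁, hP₁', hval⟩ := h τ₀ hτ₀
  have key : ∀ τ, IsState τ → 1 - δ ≤ (P₀ * ω).trace.re - c * (partialTrace P₀ * τ).trace.re := by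
    intro τ hτ
    rw [← hf']
    exact hval.trans (hsad τ hτ P₁ ⟨hP₁, hP₁'⟩)
  have hpt := partialTrace_posSemidef hP₀.1
  refine ⟨P₀, hP₀.1, hP₀.2, ?_, ?_⟩
  · have := re_trace_mul_nonneg hpt hτ₀.1
    nlinarith [key τ₀ hτ₀, mul_nonneg hc this]
  · have hle : (P₀ * ω).trace.re ≤ 1 := by
      have := re_trace_effect_mul_le hP₀.2 hω.1
      rwa [hω.2] at this
    have hherm : ((δ : ℂ) • (1 : Op b) - (c : ℂ) • partialTrace P₀).IsHermitian := by
      have h1 : (partialTrace P₀)ᴴ = partialTrace P₀ := hpt.1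
      simp [Matrix.IsHermitian, Matrix.conjTranspose_sub, Matrix.conjTranspose_smul, h1]
    refine Matrix.PosSemidef.of_dotProduct_mulVec_nonneg hherm fun v => ?_
    have hv := star_dotProduct_self_eq v
    have hq : star v ⬝ᵥ (partialTrace P₀ *ᵥ v)
        = ((star v ⬝ᵥ (partialTrace P₀ *ᵥ v)).re : ℂ) := by
      have h0 := Complex.nonneg_iff.1 (hpt.dotProduct_mulVec_nonneg v)
      exact Complex.ext rfl (by simpa using h0.2.symm)
    have hexp : star v ⬝ᵥ (((δ : ℂ) • (1 : Op b) - (c : ℂ) • partialTrace P₀) *ᵥ v)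
        = ((δ * (star v ⬝ᵥ v).re - c * (star v ⬝ᵥ (partialTrace P₀ *ᵥ v)).re : ℝ) : ℂ) := by
      rw [Matrix.sub_mulVec, Matrix.smul_mulVec, Matrix.smul_mulVec, Matrix.one_mulVec,
        dotProduct_sub, dotProduct_smul, dotProduct_smul, smul_eq_mul, smul_eq_mul]
      push_cast
      rw [← hv, ← hq]
    rw [hexp, Complex.zero_le_real]
    rcases (Complex.nonneg_iff.1 (dotProduct_star_self_nonneg v)).1.eq_or_lt with h0 | h0
    · have hv0 : v = 0 := by
        rw [← dotProduct_star_self_eq_zero, hv, ← h0, Complex.ofReal_zero]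
      simp [hv0]
    · have h1 := key _ (isState_vecMulVec h0 hv)
      rw [Matrix.mul_smul, Matrix.trace_smul, smul_eq_mul, Complex.re_ofReal_mul,
        Matrix.trace_mul_comm (partialTrace P₀), ← star_dotProduct_mulVec_eq_trace] at h1
      set t := (star v ⬝ᵥ v).re with ht
      have h2 : c * (t⁻¹ * (star v ⬝ᵥ (partialTrace P₀ *ᵥ v)).re) ≤ δ := by linarith
      have h3 := mul_le_mul_of_nonneg_left h2 h0.le
      have h4 : t * (c * (t⁻¹ * (star v ⬝ᵥ (partialTrace P₀ *ᵥ v)).re))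
          = c * (star v ⬝ᵥ (partialTrace P₀ *ᵥ v)).re := by
        field_simp
      linarith

end Minimax

/-! ### Achievability -/

section Achievability

variable {a b : Type} [Fintype a] [Fintype b]

theorem isMES_mesVec (M : ℕ) : IsMES M (vecMulVec (mesVec M) (star (mesVec M))) := by
  refine ⟨fun i => EuclideanSpace.single i 1, fun i => EuclideanSpace.single i 1,
    EuclideanSpace.orthonormal_single, EuclideanSpace.orthonormal_single, ?_⟩
  have h : mesVec M = fun p : Fin M × Fin M => (((√(M : ℝ))⁻¹ : ℝ) : ℂ) *
      ∑ i, (EuclideanSpace.single i (1 : ℂ) : EuclideanSpace ℂ (Fin M)) p.1 *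
        (EuclideanSpace.single i (1 : ℂ) : EuclideanSpace ℂ (Fin M)) p.2 := by
    ext p
    simp [mesVec]
  simp only [← h]

theorem IsOneWayLOCC.isState {a' b' : Type} [Fintype a'] [Fintype b']
    {Λ : Op (a × b) →ₗ[ℂ] Op (a' × b')} (h : IsOneWayLOCC Λ) {ρ : Op (a × b)} (hρ : IsState ρ) :
    IsState (Λ ρ) :=
  ⟨h.posSemidef_and_isTP.1 _ hρ.1, (h.posSemidef_and_isTP.2 ρ).trans hρ.2⟩

/-- The fidelity with a pure state is the square root of the overlap, hence at least the overlap. -/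
theorem OneWayAchievable.of_form {ρ : Op (a × b)} (hρ : IsState ρ) {M : ℕ} {ε R : ℝ}
    (hR : 0 ≤ R) (hM : (2 : ℝ) ^ R ≤ M) {Λ : Op (a × b) →ₗ[ℂ] Op (Fin M × Fin M)}
    (hΛ : IsOneWayLOCC Λ) (hε : 0 ≤ ε)
    (h : 1 - ε ≤ (star (mesVec M) ⬝ᵥ (Λ ρ *ᵥ mesVec M)).re) : OneWayAchievable ρ ε R := by
  refine ⟨hR, M, M, M, _, Λ, hM, isMES_mesVec M, hΛ, ?_⟩
  rw [fidelity_vecMulVec (hΛ.isState hρ).1]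
  rcases le_total (1 - ε) 0 with h0 | h0
  · exact h0.trans (Real.sqrt_nonneg _)
  · refine Real.le_sqrt_of_sq_le ?_
    nlinarith

/-- One-shot achievability: if the tests in the definition of the spectral divergence rate detect
`ω` against `1 ⊗ τ` for each state `τ`, then `R` ebits can be distilled. -/
theorem exists_oneWayAchievable [DecidableEq a] [DecidableEq b] {ω : Op (a × b)}
    (hω : IsState ω) {R δ : ℝ} (hR : 0 ≤ R) (hδ : 0 < δ) (hδ1 : δ ≤ 1)
    (h : ∀ τ : Op b, IsState τ →
      1 - δ ≤ (nonnegProj (ω - ((2 : ℝ) ^ R) • ((1 : Op a) ⊗ₖ τ))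
        * (ω - ((2 : ℝ) ^ R) • ((1 : Op a) ⊗ₖ τ))).trace.re) :
    OneWayAchievable ω (6 * √ δ) R := by
  have hne : Nonempty (a × b) := by
    by_contra hemp
    rw [not_nonempty_iff] at hemp
    have := hω.2
    simp [Matrix.trace] at this
  have : Nonempty b := hne.map Prod.snd
  set c : ℝ := (2 : ℝ) ^ R with hc
  have hc1 : 1 ≤ c := Real.one_le_rpow (by norm_num) hR
  have hc0 : 0 < c := by linarith
  obtain ⟨P, hP, hP1, ht, hlam⟩ := exists_effect_of_forall_state (ω := ω) (c := c) (δ := δ)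
    (fun τ hτ => ⟨_, nonnegProj_posSemidef _, one_sub_nonnegProj_posSemidef _, h τ hτ⟩) hω hc0.le
  -- Since `c ≥ 1`, rounding up at most doubles the dimension, so that `M * (δ / c) ≤ 2 * δ`.
  set M : ℕ := ⌈c⌉₊ with hM
  have hcM : c ≤ M := Nat.le_ceil c
  have hM2 : (M : ℝ) ≤ 2 * c := by
    have := Nat.ceil_lt_add_one hc0.le
    linarith
  have : NeZero M := ⟨by rintro h0; rw [h0] at hcM; norm_num at hcM; linarith⟩
  have hlam' : (((δ / c : ℝ) : ℂ) • (1 : Op b) - partialTrace P).PosSemidef := by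
    have h1 := hlam.smul (Complex.zero_le_real.2 (inv_nonneg.2 hc0.le))
    have hcC : (c : ℂ) ≠ 0 := by exact_mod_cast hc0.ne'
    rw [smul_sub, smul_smul, smul_smul, Complex.ofReal_inv, inv_mul_cancel₀ hcC, one_smul] at h1
    convert h1 using 3
    push_cast
    rw [div_eq_inv_mul]
  have hs0 : 0 < √ δ := Real.sqrt_pos.2 hδ
  have hss : √ δ * √ δ = δ := Real.mul_self_sqrt hδ.le
  -- The choice `κ = δ ^ (-1/2)` balances the errors `κ * δ` and `κ⁻¹`; the total error is then
  -- at most `4 * δ + 2 * √δ ≤ 6 * √δ`.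
  obtain ⟨Λ, hΛ, hval⟩ := exists_oneWayLOCC_of_effect (M := M) (κ := (√ δ)⁻¹) hω hP hP1 hlam'
    (inv_pos.2 hs0)
  refine OneWayAchievable.of_form hω hR hcM hΛ (by positivity) (le_trans ?_ hval)
  set t := (P * ω).trace.re with htdef
  have h1 : (M : ℝ) * (δ / c) ≤ 2 * δ := by
    rw [mul_div_assoc', div_le_iff₀ hc0]
    nlinarith
  have h2 : (√ δ)⁻¹ * (1 - t) ≤ √ δ := by
    rw [inv_mul_le_iff₀ hs0, hss]
    linarith
  have h3 : (1 - δ) * (1 - δ) ≤ t * (1 - M * (δ / c) / 2) :=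
    mul_le_mul ht (by linarith) (by linarith) (by linarith)
  have h4 : δ ≤ √ δ := Real.le_sqrt_of_sq_le (by nlinarith)
  rw [inv_inv]
  nlinarith

/-- The trace, as a map into operators on a one-dimensional space. -/
def traceOut (a : Type) [Fintype a] [DecidableEq a] : Op a →ₗ[ℂ] Op (Fin 1) :=
  krausMap fun k : a => Matrix.of fun _ j => if k = j then 1 else 0

theorem isTP_traceOut (a : Type) [Fintype a] [DecidableEq a] : IsTP (traceOut a) := by
  refine isTP_krausMap ?_
  ext k k'
  simp [Matrix.sum_apply, Matrix.mul_apply, Matrix.one_apply, eq_comm]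

theorem oneWayAchievable_zero {ρ : Op (a × b)} (hρ : IsState ρ) {ε : ℝ} (hε : 0 ≤ ε) :
    OneWayAchievable ρ ε 0 := by
  classical
  have hΛ : IsOneWayLOCC (∑ _x : Fin 1, onRight (Fin 1) (traceOut b) ∘ₗ onLeft b (traceOut a)) :=
    isOneWayLOCC_sum (fun _ => traceOut a) (fun _ => traceOut b) (fun _ => isCP_krausMap _)
      (by simpa using isTP_traceOut a) fun _ => ⟨isCP_krausMap _, isTP_traceOut b⟩
  refine OneWayAchievable.of_form hρ (M := 1) le_rfl (by simp) hΛ hε ?_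
  have h := (hΛ.isState hρ).2
  set X := (∑ _x : Fin 1, onRight (Fin 1) (traceOut b) ∘ₗ onLeft b (traceOut a)) ρ
  have h1 : star (mesVec 1) ⬝ᵥ (X *ᵥ mesVec 1) = X.trace := by
    simp [dotProduct, Matrix.mulVec, mesVec, Matrix.trace, Fintype.sum_prod_type]
  rw [h1, h]
  simpa using hε

theorem OneWayAchievable.of_output [DecidableEq b] {I : Instrument a} {ρ : Op (a × b)} {ε R : ℝ}
    (h : OneWayAchievable (I.output ρ) ε R) : OneWayAchievable ρ ε R := by
  obtain ⟨hR, M, dA, dB, Ψ, Λ, hM, hΨ, hΛ, hF⟩ := h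
  obtain ⟨Λ', hΛ', h'⟩ := hΛ.comp_output I
  exact ⟨hR, M, dA, dB, Ψ, Λ', hM, hΨ, hΛ', by rwa [h']⟩

end Achievability

section Sequences

theorem OneWayAchievable.twoWay_of_map {a b : Type} {Λ : TwoWayLOCC a b} {ρ : Op (a × b)} {ε R : ℝ}
    (h : OneWayAchievable (Λ.map ρ) ε R) : TwoWayAchievable ρ ε R := by
  obtain ⟨hR, M, dA, dB, Ψ, Λ', hM, hΨ, hΛ', hF⟩ := h
  exact ⟨hR, M, dA, dB, Ψ, Λ' ∘ₗ Λ.map, hM, hΨ, hΛ'.isTwoWayLOCC.comp Λ.isTwoWayLOCC, hF⟩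

/-- The projector for the larger constant is a test for the smaller one. -/
theorem re_trace_nonnegProj_mul_antitone {m : Type} [Fintype m] [DecidableEq m] {ω σ : Op m}
    (hω : ω.IsHermitian) (hσ : σ.PosSemidef) {c c' : ℝ} (hc : c ≤ c') :
    (nonnegProj (ω - c' • σ) * (ω - c' • σ)).trace.re
      ≤ (nonnegProj (ω - c • σ) * (ω - c • σ)).trace.re := by
  have hherm : (ω - c • σ).IsHermitian := by
    refine hω.sub ?_
    have : σᴴ = σ := hσ.1
    simp [Matrix.IsHermitian, Matrix.conjTranspose_smul, this]
  have h1 := re_apply_le_re_trace_nonnegProj_mul hherm (traceMul (nonnegProj (ω - c' • σ)))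
    (fun Y hY => re_trace_mul_nonneg (nonnegProj_posSemidef _) hY)
    (fun Y hY => re_trace_effect_mul_le (one_sub_nonnegProj_posSemidef _) hY)
  refine le_trans ?_ h1
  rw [traceMul_apply, Matrix.mul_sub, Matrix.mul_sub, Matrix.trace_sub, Matrix.trace_sub,
    Matrix.mul_smul, Matrix.mul_smul, Matrix.trace_smul, Matrix.trace_smul, Complex.sub_re,
    Complex.sub_re, Complex.smul_re, Complex.smul_re, smul_eq_mul, smul_eq_mul]
  have h2 := re_trace_mul_nonneg (nonnegProj_posSemidef (ω - c' • σ)) hσ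
  nlinarith

variable {α β : ℕ → Type} [∀ n, Fintype (α n)] [∀ n, DecidableEq (α n)]
  [∀ n, Fintype (β n)] [∀ n, DecidableEq (β n)]

/-- Below the coherent information rate, the tests succeed uniformly over all states `τ`: otherwise
the states on which they fail would form a sequence with a smaller divergence rate. -/
theorem eventually_forall_state {ω : ∀ n, Op (α n × β n)} (hω : ∀ n, IsState (ω n)) {γ : ℝ}
    (hγ : (γ : EReal) < infCoherentRate ω) {δ : ℝ} (hδ : 0 < δ) :
    ∀ᶠ n : ℕ in atTop, ∀ τ : Op (β n), IsState τ →
      1 - δ ≤ (nonnegProj (ω n - ((2 : ℝ) ^ ((n : ℝ) * γ)) • ((1 : Op (α n)) ⊗ₖ τ))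
        * (ω n - ((2 : ℝ) ^ ((n : ℝ) * γ)) • ((1 : Op (α n)) ⊗ₖ τ))).trace.re := by
  by_contra hcon
  rw [not_eventually] at hcon
  have hne : ∀ n, Nonempty (β n) := by
    intro n
    by_contra hemp
    rw [not_nonempty_iff] at hemp
    have := (hω n).2
    simp [Matrix.trace] at this
  have hchoice : ∀ n, ∃ τ : Op (β n), IsState τ ∧ ((¬ ∀ τ : Op (β n), IsState τ →
      1 - δ ≤ (nonnegProj (ω n - ((2 : ℝ) ^ ((n : ℝ) * γ)) • ((1 : Op (α n)) ⊗ₖ τ))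
        * (ω n - ((2 : ℝ) ^ ((n : ℝ) * γ)) • ((1 : Op (α n)) ⊗ₖ τ))).trace.re) →
      (nonnegProj (ω n - ((2 : ℝ) ^ ((n : ℝ) * γ)) • ((1 : Op (α n)) ⊗ₖ τ))
        * (ω n - ((2 : ℝ) ^ ((n : ℝ) * γ)) • ((1 : Op (α n)) ⊗ₖ τ))).trace.re < 1 - δ) := by
    intro n
    by_cases hn : ∀ τ : Op (β n), IsState τ →
      1 - δ ≤ (nonnegProj (ω n - ((2 : ℝ) ^ ((n : ℝ) * γ)) • ((1 : Op (α n)) ⊗ₖ τ))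
        * (ω n - ((2 : ℝ) ^ ((n : ℝ) * γ)) • ((1 : Op (α n)) ⊗ₖ τ))).trace.re
    · obtain ⟨τ, hτ⟩ := exists_isState (β n)
      exact ⟨τ, hτ, fun h => absurd hn h⟩
    · push Not at hn
      obtain ⟨τ, hτ, hlt⟩ := hn
      exact ⟨τ, hτ, fun _ => hlt⟩
  choose τ hτ hbad using hchoice
  have h1 : (γ : EReal) < infDivergenceRate ω (fun n => (1 : Op (α n)) ⊗ₖ τ n) :=
    hγ.trans_le (iInf₂_le τ hτ)
  simp only [infDivergenceRate, lt_iSup_iff] at h1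
  obtain ⟨γ', hlim, hlt⟩ := h1
  have hγγ' : γ < γ' := EReal.coe_lt_coe_iff.1 hlt
  have h2 : ((1 - δ : ℝ) : EReal) < liminf (fun n : ℕ =>
      (((nonnegProj (diffOp ω (fun n => (1 : Op (α n)) ⊗ₖ τ n) γ' n)
        * diffOp ω (fun n => (1 : Op (α n)) ⊗ₖ τ n) γ' n).trace.re : ℝ) : EReal)) atTop := by
    rw [hlim]
    exact_mod_cast (by linarith : 1 - δ < 1)
  have h3 := eventually_lt_of_lt_liminf h2
  obtain ⟨n, hn1, hn2⟩ := (hcon.and_eventually h3).exists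
  have h4 := hbad n hn1
  have h5 := EReal.coe_lt_coe_iff.1 hn2
  have h6 := re_trace_nonnegProj_mul_antitone (hω n).1.1
    (one_kronecker_posSemidef (m := α n) (hτ n).1)
    (Real.rpow_le_rpow_of_exponent_le one_le_two
      (mul_le_mul_of_nonneg_left hγγ'.le (Nat.cast_nonneg n)))
  rw [diffOp] at h5
  linarith

theorem eventually_exists_oneWayAchievable {ω : ∀ n, Op (α n × β n)} (hω : ∀ n, IsState (ω n))
    {γ : ℝ} (hγ : (γ : EReal) < infCoherentRate ω) {ε : ℝ} (hε : 0 < ε) (hε1 : ε ≤ 1) :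
    ∀ᶠ n : ℕ in atTop, ∃ R : ℝ, (n : ℝ) * γ ≤ R ∧ OneWayAchievable (ω n) ε R := by
  rcases le_or_gt 0 γ with h0 | h0
  · have hδ : 0 < (ε / 6) ^ 2 := by positivity
    filter_upwards [eventually_forall_state hω hγ hδ] with n hn
    refine ⟨_, le_rfl, ?_⟩
    have := exists_oneWayAchievable (hω n) (by positivity) hδ (by nlinarith) hn
    rwa [Real.sqrt_sq (by positivity), mul_div_cancel₀ _ (by norm_num)] at this
  -- The rate `0` is always achievable.
  · refine Eventually.of_forall fun n => ⟨0, ?_, oneWayAchievable_zero (hω n) hε.le⟩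
    exact mul_nonpos_of_nonneg_of_nonpos (Nat.cast_nonneg n) h0.le

theorem le_liminf_inv_mul {E : ℕ → EReal} {γ : ℝ}
    (h : ∀ᶠ n : ℕ in atTop, (((n : ℝ) * γ : ℝ) : EReal) ≤ E n) :
    (γ : EReal) ≤ liminf (fun n : ℕ => (((n : ℝ)⁻¹ : ℝ) : EReal) * E n) atTop := by
  refine le_liminf_of_le (by isBoundedDefault) ?_
  filter_upwards [h, eventually_ge_atTop 1] with n hn h1
  have hn0 : (n : ℝ) ≠ 0 := by positivity
  calc (γ : EReal) = (((n : ℝ)⁻¹ : ℝ) : EReal) * (((n : ℝ) * γ : ℝ) : EReal) := by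
        rw [← EReal.coe_mul, inv_mul_cancel_left₀ hn0]
    _ ≤ _ := mul_le_mul_of_nonneg_left hn (EReal.coe_nonneg.2 (by positivity))

/-- Achievability for one-way protocols: the code is applied to the output of the instrument. -/
theorem infCoherentRate_output_le {a b : Type} [Fintype a] [Fintype b] [DecidableEq b]
    {ρ : ∀ n : ℕ, OpN a b n} (hρ : ∀ n, IsState (ρ n)) (I : ∀ n : ℕ, Instrument (Fin n → a)) :
    infCoherentRate (α := fun n => Fin (I n).dim) (β := fun n => (Fin n → b) × Fin (I n).card)
      (fun n => (I n).output (ρ n)) ≤ oneWayDistillable ρ := by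
  refine EReal.ge_of_forall_gt_iff_ge.1 fun γ hγ => ?_
  refine ge_of_tendsto (tendsto_oneWayRate ρ) ?_
  filter_upwards [Ioo_mem_nhdsGT (zero_lt_one' ℝ)] with ε hε
  refine le_liminf_inv_mul ?_
  filter_upwards [eventually_exists_oneWayAchievable (fun n => (I n).output_isState (hρ n)) hγ
    hε.1 hε.2.le] with n ⟨R, hR, hach⟩
  exact (EReal.coe_le_coe_iff.2 hR).trans
    (le_iSup₂ (f := fun (R : ℝ) (_ : OneWayAchievable (ρ n) ε R) => (R : EReal)) R hach.of_output)

theorem TwoWayLOCC.isState {a b : Type} [Fintype a] [Fintype b] (Λ : TwoWayLOCC a b)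
    {ρ : Op (a × b)} (hρ : IsState ρ) : IsState (Λ.map ρ) :=
  ⟨Λ.isTwoWayLOCC.posSemidef_and_isTP.1 _ hρ.1,
    (Λ.isTwoWayLOCC.posSemidef_and_isTP.2 ρ).trans hρ.2⟩

/-- Achievability for two-way protocols: the code is applied to the output of the protocol. -/
theorem infCoherentRate_map_le {a b : Type} [Fintype a] [Fintype b]
    {ρ : ∀ n : ℕ, OpN a b n} (hρ : ∀ n, IsState (ρ n))
    (Λ : ∀ n : ℕ, TwoWayLOCC (Fin n → a) (Fin n → b)) :
    infCoherentRate (α := fun n => Fin (Λ n).dimA) (β := fun n => Fin (Λ n).dimB)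
      (fun n => (Λ n).map (ρ n)) ≤ twoWayDistillable ρ := by
  refine EReal.ge_of_forall_gt_iff_ge.1 fun γ hγ => ?_
  refine ge_of_tendsto (tendsto_twoWayRate ρ) ?_
  filter_upwards [Ioo_mem_nhdsGT (zero_lt_one' ℝ)] with ε hε
  refine le_liminf_inv_mul ?_
  filter_upwards [eventually_exists_oneWayAchievable (fun n => (Λ n).isState (hρ n)) hγ
    hε.1 hε.2.le] with n ⟨R, hR, hach⟩
  exact (EReal.coe_le_coe_iff.2 hR).trans
    (le_iSup₂ (f := fun (R : ℝ) (_ : TwoWayAchievable (ρ n) ε R) => (R : EReal)) R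
      hach.twoWay_of_map)

end Sequences

/-! ### The converse -/

section Tests

variable {a b : Type} [Fintype a] [Fintype b]

/-- A maximally entangled state has overlap at most `1 / M` with each operator `1 ⊗ τ`, because its
reduced state on `b` is `1 / M` times a projector. -/
theorem IsMES.exists_vector [DecidableEq a] {M : ℕ} [NeZero M] {Ψ : Op (a × b)} (h : IsMES M Ψ) :
    ∃ ψ : a × b → ℂ, Ψ = vecMulVec ψ (star ψ) ∧ star ψ ⬝ᵥ ψ = 1 ∧
      ∀ τ : Op b, IsState τ → (star ψ ⬝ᵥ (((1 : Op a) ⊗ₖ τ) *ᵥ ψ)).re ≤ (M : ℝ)⁻¹ := by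
  classical
  obtain ⟨e, f, he, hf, hΨ⟩ := h
  have hM : (0 : ℝ) < M := by exact_mod_cast Nat.pos_of_ne_zero (NeZero.ne M)
  let E : Matrix a (Fin M) ℂ := Matrix.of fun p i => e i p
  let F : Matrix b (Fin M) ℂ := Matrix.of fun p i => f i p
  have hE : Eᴴ * E = 1 := by
    ext i j
    have := orthonormal_iff_ite.1 he i j
    rw [Matrix.one_apply, ← this]
    simp [E, Matrix.mul_apply, PiLp.inner_apply, mul_comm]
  have hF : Fᴴ * F = 1 := by
    ext i j
    have := orthonormal_iff_ite.1 hf i j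
    rw [Matrix.one_apply, ← this]
    simp [F, Matrix.mul_apply, PiLp.inner_apply, mul_comm]
  set ψ : a × b → ℂ := fun p => ((√(M : ℝ))⁻¹ : ℝ) * ∑ i, e i p.1 * f i p.2 with hψ
  have hψC : ∀ p q, ψ (p, q) = ((√(M : ℝ))⁻¹ : ℝ) * (E * Fᵀ) p q := by
    intro p q
    simp [hψ, E, F, Matrix.mul_apply]
  have hform : ∀ X : Op b, star ψ ⬝ᵥ (((1 : Op a) ⊗ₖ X) *ᵥ ψ)
      = (((M : ℝ)⁻¹ : ℝ) : ℂ) * (X * (F * Fᴴ)).trace := by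
    intro X
    have hC : ((E * Fᵀ)ᴴ * (E * Fᵀ))ᵀ = F * Fᴴ := by
      rw [Matrix.conjTranspose_mul, Matrix.mul_assoc, ← Matrix.mul_assoc Eᴴ, hE, Matrix.one_mul,
        Matrix.transpose_mul]
      rfl
    have hk : (((√(M : ℝ))⁻¹ : ℝ) : ℂ) * (((√(M : ℝ))⁻¹ : ℝ) : ℂ) = (((M : ℝ)⁻¹ : ℝ) : ℂ) := by
      rw [← Complex.ofReal_mul, ← mul_inv, Real.mul_self_sqrt hM.le]
    have hX : ∀ p q, (((1 : Op a) ⊗ₖ X) *ᵥ ψ) (p, q) = ∑ q', X q q' * ψ (p, q') := by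
      intro p q
      simp only [Matrix.mulVec, dotProduct, Fintype.sum_prod_type, Matrix.kroneckerMap_apply]
      rw [Fintype.sum_eq_single p fun p' hp => Finset.sum_eq_zero fun q' _ => by
        rw [Matrix.one_apply_ne hp.symm, zero_mul, zero_mul]]
      simp
    have hR : ∀ q, (X * ((E * Fᵀ)ᴴ * (E * Fᵀ))ᵀ) q q
        = ∑ q', X q q' * ∑ p, star ((E * Fᵀ) p q) * (E * Fᵀ) p q' := by
      intro q
      rw [Matrix.mul_apply]
      refine Finset.sum_congr rfl fun q' _ => ?_
      rw [Matrix.transpose_apply, Matrix.mul_apply]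
      rfl
    rw [← hC, ← hk]
    simp only [Matrix.trace, Matrix.diag, hR, dotProduct, Fintype.sum_prod_type_right, hX,
      Pi.star_apply, hψC, star_mul, Complex.star_def, Complex.conj_ofReal, Finset.mul_sum]
    refine Finset.sum_congr rfl fun q _ => ?_
    rw [Finset.sum_comm]
    refine Finset.sum_congr rfl fun q' _ => Finset.sum_congr rfl fun p _ => ?_
    ring
  refine ⟨ψ, hΨ, ?_, ?_⟩
  · have := hform 1
    rw [Matrix.one_kronecker_one, Matrix.one_mulVec, Matrix.one_mul, Matrix.trace_mul_comm, hF,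
      Matrix.trace_one, Fintype.card_fin] at this
    rw [this]
    push_cast
    exact inv_mul_cancel₀ (by exact_mod_cast hM.ne')
  · intro τ hτ
    rw [hform, Complex.re_ofReal_mul]
    have h1 : (1 - F * Fᴴ).PosSemidef := by
      have h2 : 1 - F * Fᴴ = (1 - F * Fᴴ)ᴴ * (1 - F * Fᴴ) := by
        have h3 : (F * Fᴴ)ᴴ = F * Fᴴ := by simp
        have h4 : F * Fᴴ * (F * Fᴴ) = F * Fᴴ := by
          rw [Matrix.mul_assoc, ← Matrix.mul_assoc Fᴴ, hF, Matrix.one_mul]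
        rw [Matrix.conjTranspose_sub, h3, Matrix.conjTranspose_one, Matrix.sub_mul,
          Matrix.mul_sub (F * Fᴴ), h4]
        simp
      rw [h2]
      exact Matrix.posSemidef_conjTranspose_mul_self _
    have h2 := re_trace_effect_mul_le h1 hτ.1
    rw [hτ.2, Matrix.trace_mul_comm, Complex.one_re] at h2
    calc (M : ℝ)⁻¹ * (τ * (F * Fᴴ)).trace.re ≤ (M : ℝ)⁻¹ * 1 := by gcongr
      _ = _ := mul_one _

/-- There is a test that accepts `ω` with probability at least `(1 - ε)²`, and accepts `1 ⊗ τ` with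
weight at most `2 ^ (-R)` for each state `τ`. The test is given by its acceptance functional. -/
def HasTest [DecidableEq a] (ω : Op (a × b)) (ε R : ℝ) : Prop :=
  ∃ f : Op (a × b) →ₗ[ℂ] ℂ, (∀ Y, Y.PosSemidef → 0 ≤ (f Y).re) ∧
    (∀ Y, Y.PosSemidef → (f Y).re ≤ Y.trace.re) ∧ (1 - ε) ^ 2 ≤ (f ω).re ∧
    ∀ τ : Op b, IsState τ → (f ((1 : Op a) ⊗ₖ τ)).re ≤ (2 : ℝ) ^ (-R)

theorem hasTest_of_fidelity [DecidableEq a] [DecidableEq b] {ω : Op (a × b)} (hω : IsState ω)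
    {M : ℕ} {Ψ : Op (a × b)} (hΨ : IsMES M Ψ) {ε R : ℝ} (hε : ε ≤ 1) (hR : (2 : ℝ) ^ R ≤ M)
    (hF : 1 - ε ≤ fidelity ω Ψ) : HasTest ω ε R := by
  have h2R : (0 : ℝ) < (2 : ℝ) ^ R := by positivity
  have : NeZero M := ⟨by rintro rfl; norm_num at hR; linarith⟩
  obtain ⟨ψ, rfl, hψ1, hψτ⟩ := hΨ.exists_vector
  refine ⟨traceMul (vecMulVec ψ (star ψ)), fun Y hY => ?_, fun Y hY => ?_, ?_, fun τ hτ => ?_⟩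
  · rw [traceMul_apply, ← star_dotProduct_mulVec_eq_trace]
    exact re_star_dotProduct_mulVec_nonneg ψ hY
  · rw [traceMul_apply, ← star_dotProduct_mulVec_eq_trace]
    exact re_star_dotProduct_mulVec_le hψ1 hY
  · rw [traceMul_apply, ← star_dotProduct_mulVec_eq_trace]
    rw [fidelity_vecMulVec hω.1] at hF
    calc (1 - ε) ^ 2 ≤ √ (star ψ ⬝ᵥ (ω *ᵥ ψ)).re ^ 2 := by
          have : 0 ≤ 1 - ε := by linarith
          gcongr
      _ = _ := Real.sq_sqrt (re_star_dotProduct_mulVec_nonneg ψ hω.1)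
  · rw [traceMul_apply, ← star_dotProduct_mulVec_eq_trace]
    refine (hψτ τ hτ).trans ?_
    rw [Real.rpow_neg (by norm_num)]
    exact inv_anti₀ h2R hR

/-- The channel `∑ x, id ⊗ D x ⊗ ⟨x| · |x⟩`, which applies `D x` depending on the value of the
classical register. -/
def controlledMap (c : Type) {b b' : Type} {k : ℕ} (D : Fin k → (Op b →ₗ[ℂ] Op b')) :
    Op (c × (b × Fin k)) →ₗ[ℂ] Op (c × b') where
  toFun X := ∑ x, onRight c (D x)
    (X.submatrix (fun p => (p.1, (p.2, x))) fun p => (p.1, (p.2, x)))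
  map_add' X Y := by
    rw [← Finset.sum_add_distrib]
    exact Finset.sum_congr rfl fun x _ => map_add (onRight c (D x)) _ _
  map_smul' z X := by
    rw [Finset.smul_sum]
    exact Finset.sum_congr rfl fun x _ => map_smul (onRight c (D x)) _ _

theorem controlledMap_apply {c b b' : Type} {k : ℕ} (D : Fin k → (Op b →ₗ[ℂ] Op b'))
    (X : Op (c × (b × Fin k))) :
    controlledMap c D X = ∑ x, onRight c (D x)
      (X.submatrix (fun p => (p.1, (p.2, x))) fun p => (p.1, (p.2, x))) := rfl

theorem controlledMap_posSemidef {c b b' : Type} [Fintype c] {k : ℕ}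
    {D : Fin k → (Op b →ₗ[ℂ] Op b')} (hD : ∀ x, IsCP (D x)) {X : Op (c × (b × Fin k))}
    (hX : X.PosSemidef) : (controlledMap c D X).PosSemidef :=
  Matrix.posSemidef_sum _ fun x _ => (hD x).onRight_posSemidef (hX.submatrix _)

theorem isTP_controlledMap {c b b' : Type} [Fintype c] [Fintype b] [Fintype b'] {k : ℕ}
    {D : Fin k → (Op b →ₗ[ℂ] Op b')} (hD : ∀ x, IsTP (D x)) : IsTP (controlledMap c D) := by
  intro X
  rw [controlledMap_apply, Matrix.trace_sum]
  simp only [((hD _).onRight : IsTP (onRight c _)) _]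
  simp only [Matrix.trace, Matrix.diag, Fintype.sum_prod_type, Matrix.submatrix_apply]
  rw [Finset.sum_comm]
  exact Finset.sum_congr rfl fun i _ => Finset.sum_comm

theorem controlledMap_output {b b' : Type} (I : Instrument a)
    (D : Fin I.card → (Op b →ₗ[ℂ] Op b')) (ρ : Op (a × b)) :
    controlledMap (Fin I.dim) D (I.output ρ)
      = (∑ x, onRight (Fin I.dim) (D x) ∘ₗ onLeft b (I.map x)) ρ := by
  rw [controlledMap_apply, LinearMap.sum_apply]
  refine Finset.sum_congr rfl fun x _ => ?_
  rw [LinearMap.comp_apply]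
  congr 1
  ext p q
  simp [Instrument.output]

theorem controlledMap_one_kronecker {c b b' : Type} [DecidableEq c] {k : ℕ}
    (D : Fin k → (Op b →ₗ[ℂ] Op b')) (τ : Op (b × Fin k)) :
    controlledMap c D ((1 : Op c) ⊗ₖ τ)
      = (1 : Op c) ⊗ₖ ∑ x, D x (τ.submatrix (fun j => (j, x)) fun j => (j, x)) := by
  rw [controlledMap_apply]
  ext ⟨p, p'⟩ ⟨q, q'⟩
  rw [Matrix.sum_apply, Matrix.kroneckerMap_apply, Matrix.sum_apply, Finset.mul_sum]
  refine Finset.sum_congr rfl fun x _ => ?_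
  have : (Matrix.of fun i j => (((1 : Op c) ⊗ₖ τ).submatrix
      (fun p : c × b => (p.1, (p.2, x))) fun p => (p.1, (p.2, x))) (p, i) (q, j))
      = (1 : Op c) p q • τ.submatrix (fun j => (j, x)) fun j => (j, x) := by
    ext i j
    simp
  simp only [onRight, LinearMap.coe_mk, AddHom.coe_mk, this, map_smul, Matrix.of_apply,
    Matrix.smul_apply, smul_eq_mul]

theorem isState_sum_block {b b' : Type} [Fintype b] [Fintype b'] {k : ℕ}
    {D : Fin k → (Op b →ₗ[ℂ] Op b')} (hD : ∀ x, IsCP (D x) ∧ IsTP (D x)) {τ : Op (b × Fin k)}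
    (hτ : IsState τ) : IsState (∑ x, D x (τ.submatrix (fun j => (j, x)) fun j => (j, x))) := by
  refine ⟨Matrix.posSemidef_sum _ fun x _ => (hD x).1.posSemidef (hτ.1.submatrix _), ?_⟩
  rw [← hτ.2, Matrix.trace_sum]
  simp only [(hD _).2 _]
  simp only [Matrix.trace, Matrix.diag, Fintype.sum_prod_type_right, Matrix.submatrix_apply]

/-- A one-way protocol yields a test on the output of Alice's instrument: the maximally entangled
state, pulled back along Bob's operations. -/
theorem OneWayAchievable.exists_hasTest {ρ : Op (a × b)} (hρ : IsState ρ) {ε R : ℝ}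
    (h : OneWayAchievable ρ ε R) (hε : ε ≤ 1) :
    ∃ I : Instrument a, HasTest (I.output ρ) ε R := by
  classical
  obtain ⟨-, M, dA, dB, Ψ, Λ, hM, hΨ, hΛ, hF⟩ := h
  have hst := hΛ.isState hρ
  obtain ⟨k, E, D, hE, hD, rfl⟩ := hΛ
  obtain ⟨f, hf0, hf1, hfω, hfτ⟩ := hasTest_of_fidelity hst hΨ hε hM hF
  let I : Instrument a := ⟨dA, k, E, hE⟩
  refine ⟨I, f ∘ₗ controlledMap (Fin dA) D, fun Y hY => ?_, fun Y hY => ?_, ?_, fun τ hτ => ?_⟩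
  · exact hf0 _ (controlledMap_posSemidef (fun x => (hD x).1) hY)
  · rw [← isTP_controlledMap (fun x => (hD x).2) Y]
    exact hf1 _ (controlledMap_posSemidef (fun x => (hD x).1) hY)
  · rw [LinearMap.comp_apply]
    have := controlledMap_output I D ρ
    exact this ▸ hfω
  · rw [LinearMap.comp_apply]
    have := controlledMap_one_kronecker (c := Fin dA) D τ
    rw [this]
    exact hfτ _ (isState_sum_block hD hτ)

theorem TwoWayAchievable.exists_hasTest {ρ : Op (a × b)} (hρ : IsState ρ) {ε R : ℝ}
    (h : TwoWayAchievable ρ ε R) (hε : ε ≤ 1) :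
    ∃ Λ : TwoWayLOCC a b, HasTest (Λ.map ρ) ε R := by
  obtain ⟨-, M, dA, dB, Ψ, Λ, hM, hΨ, hΛ, hF⟩ := h
  let Λ' : TwoWayLOCC a b := ⟨dA, dB, Λ, hΛ⟩
  exact ⟨Λ', hasTest_of_fidelity (Λ'.isState hρ) hΨ hε hM hF⟩

theorem OneWayAchievable.twoWayAchievable {ρ : Op (a × b)} {ε R : ℝ}
    (h : OneWayAchievable ρ ε R) : TwoWayAchievable ρ ε R := by
  obtain ⟨hR, M, dA, dB, Ψ, Λ, hM, hΨ, hΛ, hF⟩ := h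
  exact ⟨hR, M, dA, dB, Ψ, Λ, hM, hΨ, hΛ.isTwoWayLOCC, hF⟩

end Tests

section Converse

/-- A sequence of tests bounds the coherent information rate from below. -/
theorem le_infCoherentRate {α β : ℕ → Type} [∀ n, Fintype (α n)] [∀ n, DecidableEq (α n)]
    [∀ n, Fintype (β n)] [∀ n, DecidableEq (β n)] {ω : ∀ n, Op (α n × β n)}
    (hω : ∀ n, IsState (ω n)) {r : EReal} {ε R : ℕ → ℝ} (hε : Tendsto ε atTop (𝓝 0))
    (hR : ∀ z : ℝ, (z : EReal) < r → ∀ᶠ n : ℕ in atTop, (n : ℝ) * z ≤ R n)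
    (h : ∀ᶠ n in atTop, HasTest (ω n) (ε n) (R n)) : r ≤ infCoherentRate ω := by
  refine le_iInf₂ fun σ hσ => ?_
  -- For `γ < z < r` the test has weight at most `2 ^ (-n z)` on `1 ⊗ σ n`, so that its value at the
  -- operator `ω n - 2 ^ (n γ) (1 ⊗ σ n)` tends to `1`.
  refine EReal.ge_of_forall_gt_iff_ge.1 fun γ hγ => ?_
  refine le_iSup₂_of_le γ ?_ le_rfl
  obtain ⟨z, hγz, hzr⟩ := EReal.lt_iff_exists_real_btwn.1 hγ
  have hγz' : γ < z := EReal.coe_lt_coe_iff.1 hγz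
  refine Tendsto.liminf_eq ?_
  rw [← EReal.coe_one]
  refine (continuous_coe_real_ereal.tendsto 1).comp ?_
  have hlow : Tendsto (fun n : ℕ => (1 - ε n) ^ 2 - ((2 : ℝ) ^ (γ - z)) ^ n) atTop (𝓝 1) := by
    have h1 : Tendsto (fun n : ℕ => ((2 : ℝ) ^ (γ - z)) ^ n) atTop (𝓝 0) :=
      tendsto_pow_atTop_nhds_zero_of_lt_one (by positivity)
        (Real.rpow_lt_one_of_one_lt_of_neg one_lt_two (by linarith))
    have h2 := ((tendsto_const_nhds (x := (1 : ℝ))).sub hε).pow 2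
    simpa using h2.sub h1
  refine tendsto_of_tendsto_of_tendsto_of_le_of_le' hlow tendsto_const_nhds ?_ ?_
  · filter_upwards [h, hR z hzr] with n ⟨f, hf0, hf1, hfω, hfτ⟩ hRn
    have hherm : (diffOp ω (fun n => (1 : Op (α n)) ⊗ₖ σ n) γ n).IsHermitian := by
      refine (hω n).1.1.sub ?_
      have : ((1 : Op (α n)) ⊗ₖ σ n)ᴴ = (1 : Op (α n)) ⊗ₖ σ n :=
        (one_kronecker_posSemidef (hσ n).1).1
      simp only [Matrix.IsHermitian, Matrix.conjTranspose_smul, this, star_trivial]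
    refine le_trans ?_ (re_apply_le_re_trace_nonnegProj_mul hherm f hf0 hf1)
    have h3 : (f (diffOp ω (fun n => (1 : Op (α n)) ⊗ₖ σ n) γ n)).re
        = (f (ω n)).re - (2 : ℝ) ^ ((n : ℝ) * γ) * (f ((1 : Op (α n)) ⊗ₖ σ n)).re := by
      rw [diffOp, map_sub, Complex.sub_re, ← Complex.coe_smul, map_smul, smul_eq_mul,
        Complex.re_ofReal_mul]
    rw [h3]
    have h4 : (2 : ℝ) ^ ((n : ℝ) * γ) * (f ((1 : Op (α n)) ⊗ₖ σ n)).re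
        ≤ ((2 : ℝ) ^ (γ - z)) ^ n := by
      calc (2 : ℝ) ^ ((n : ℝ) * γ) * (f ((1 : Op (α n)) ⊗ₖ σ n)).re
          ≤ (2 : ℝ) ^ ((n : ℝ) * γ) * (2 : ℝ) ^ (-((n : ℝ) * z)) := by
            refine mul_le_mul_of_nonneg_left ((hfτ _ (hσ n)).trans ?_) (by positivity)
            exact Real.rpow_le_rpow_of_exponent_le one_le_two (by linarith)
        _ = ((2 : ℝ) ^ (γ - z)) ^ n := by
            rw [← Real.rpow_add two_pos, ← Real.rpow_natCast, ← Real.rpow_mul two_pos.le]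
            congr 1
            ring
    linarith
  · refine Eventually.of_forall fun n => ?_
    have h1 := re_trace_mul_nonneg (nonnegProj_posSemidef
      (diffOp ω (fun n => (1 : Op (α n)) ⊗ₖ σ n) γ n))
      (one_kronecker_posSemidef (m := α n) (hσ n).1)
    have h2 := re_trace_effect_mul_le (one_sub_nonnegProj_posSemidef
      (diffOp ω (fun n => (1 : Op (α n)) ⊗ₖ σ n) γ n)) (hω n).1
    rw [(hω n).2, Complex.one_re] at h2
    have h3 : ∀ T : Op (α n × β n),
        (T * diffOp ω (fun n => (1 : Op (α n)) ⊗ₖ σ n) γ n).trace.re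
        = (T * ω n).trace.re
          - (2 : ℝ) ^ ((n : ℝ) * γ) * (T * ((1 : Op (α n)) ⊗ₖ σ n)).trace.re := by
      intro T
      rw [diffOp, Matrix.mul_sub, Matrix.trace_sub, Complex.sub_re, Matrix.mul_smul,
        Matrix.trace_smul, Complex.smul_re, smul_eq_mul]
    rw [h3]
    have : 0 ≤ (2 : ℝ) ^ ((n : ℝ) * γ) := by positivity
    nlinarith

/-- Properties that hold eventually, for each fixed `k`, hold along some `k = φ n` tending to
infinity. -/
theorem exists_diagonal_seq {p : ℕ → ℕ → Prop} (h : ∀ k, ∀ᶠ n in atTop, p k n) :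
    ∃ φ : ℕ → ℕ, Tendsto φ atTop atTop ∧ ∀ᶠ n in atTop, p (φ n) n := by
  classical
  let q : ℕ → ℕ → Prop := fun n k => ∀ m, n ≤ m → p k m
  have hq : ∀ k, ∀ᶠ n in atTop, q n k := by
    intro k
    obtain ⟨N, hN⟩ := eventually_atTop.1 (h k)
    exact eventually_atTop.2 ⟨N, fun n hn m hm => hN m (hn.trans hm)⟩
  refine ⟨fun n => Nat.findGreatest (q n) n, ?_, ?_⟩
  · refine tendsto_atTop.2 fun k => ?_
    filter_upwards [hq k, eventually_ge_atTop k] with n hn hk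
    exact Nat.le_findGreatest hk hn
  · filter_upwards [hq 0] with n hn
    exact Nat.findGreatest_spec (P := q n) (Nat.zero_le n) hn n le_rfl

/-- A single sequence of protocols achieves the limit over the error `ε` of the optimal rates. -/
theorem exists_achieving_seq {Ach : ℕ → ℝ → ℝ → Prop} {r : EReal} (hr : 0 ≤ r)
    (h : ∀ ε : ℝ, 0 < ε → r ≤ liminf (fun n : ℕ =>
      (((n : ℝ)⁻¹ : ℝ) : EReal) * ⨆ (R : ℝ) (_ : Ach n ε R), (R : EReal)) atTop) :
    ∃ ε R : ℕ → ℝ, (∀ n, ε n ≤ 1) ∧ Tendsto ε atTop (𝓝 0) ∧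
      (∀ z : ℝ, (z : EReal) < r → ∀ᶠ n : ℕ in atTop, (n : ℝ) * z ≤ R n) ∧
      ∀ᶠ n in atTop, Ach n (ε n) (R n) := by
  -- Real numbers increasing to `r`. Their lower bound `-1` serves to keep them away from `⊥`, so
  -- that `EReal.toReal` does not change them.
  obtain ⟨u, -, hu, hulim⟩ := exists_seq_strictMono_tendsto'
    (show (((-1 : ℝ) : ℝ) : EReal) < r from lt_of_lt_of_le (by exact_mod_cast neg_one_lt_zero) hr)
  have hux : ∀ k, ((u k).toReal : EReal) = u k := fun k =>
    EReal.coe_toReal ((hu k).2.trans_le le_top).ne ((bot_le).trans_lt (hu k).1).ne'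
  have hp : ∀ k : ℕ, ∀ᶠ n : ℕ in atTop, ∃ R : ℝ, Ach n (1 / ((k : ℝ) + 1)) R ∧
      (n : ℝ) * (u k).toReal ≤ R := by
    intro k
    have h1 := eventually_lt_of_lt_liminf
      ((hu k).2.trans_le (h (1 / ((k : ℝ) + 1)) (by positivity)))
    filter_upwards [h1, eventually_ge_atTop 1] with n hn hn1
    have hn0 : (n : ℝ) ≠ 0 := by positivity
    have h2 : (((n : ℝ) * (u k).toReal : ℝ) : EReal)
        < ⨆ (R : ℝ) (_ : Ach n (1 / ((k : ℝ) + 1)) R), (R : EReal) := by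
      by_contra hcon
      refine absurd hn (not_lt.2 ?_)
      calc _ ≤ (((n : ℝ)⁻¹ : ℝ) : EReal) * (((n : ℝ) * (u k).toReal : ℝ) : EReal) :=
            mul_le_mul_of_nonneg_left (not_lt.1 hcon) (EReal.coe_nonneg.2 (by positivity))
        _ = u k := by rw [← EReal.coe_mul, inv_mul_cancel_left₀ hn0, hux]
    simp only [lt_iSup_iff] at h2
    obtain ⟨R, hR, hlt⟩ := h2
    exact ⟨R, hR, (EReal.coe_lt_coe_iff.1 hlt).le⟩
  obtain ⟨φ, hφ, hφp⟩ := exists_diagonal_seq hp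
  have hR : ∀ n : ℕ, ∃ R : ℝ, (∃ R : ℝ, Ach n (1 / ((φ n : ℝ) + 1)) R ∧
      (n : ℝ) * (u (φ n)).toReal ≤ R) → Ach n (1 / ((φ n : ℝ) + 1)) R ∧
      (n : ℝ) * (u (φ n)).toReal ≤ R := by
    intro n
    by_cases hn : ∃ R : ℝ, Ach n (1 / ((φ n : ℝ) + 1)) R ∧ (n : ℝ) * (u (φ n)).toReal ≤ R
    · obtain ⟨R, hR⟩ := hn
      exact ⟨R, fun _ => hR⟩
    · exact ⟨0, fun h => absurd h hn⟩
  choose R hR using hR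
  refine ⟨fun n => 1 / ((φ n : ℝ) + 1), R, fun n => ?_, ?_, fun z hz => ?_, ?_⟩
  · rw [div_le_one (by positivity)]
    linarith [(Nat.cast_nonneg (φ n) : (0 : ℝ) ≤ φ n)]
  · exact tendsto_one_div_add_atTop_nhds_zero_nat.comp hφ
  · filter_upwards [hφp, hφ.eventually (hulim.eventually (lt_mem_nhds hz))] with n hn hzn
    rw [← hux, EReal.coe_lt_coe_iff] at hzn
    exact (mul_le_mul_of_nonneg_left hzn.le (Nat.cast_nonneg n)).trans (hR n hn).2
  · filter_upwards [hφp] with n hn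
    exact (hR n hn).1

variable {a b : Type} [Fintype a] [Fintype b]

theorem nonempty_instrument (a : Type) [Fintype a] : Nonempty (Instrument a) := by
  classical
  exact ⟨⟨1, 1, fun _ => traceOut a, fun _ => isCP_krausMap _, by simpa using isTP_traceOut a⟩⟩

theorem le_of_monotone_of_tendsto_nhdsGT {f : ℝ → EReal} (hf : Monotone f) {r : EReal}
    (h : Tendsto f (𝓝[>] (0 : ℝ)) (𝓝 r)) {ε : ℝ} (hε : 0 < ε) : r ≤ f ε := by
  refine le_of_tendsto h ?_
  filter_upwards [Ioo_mem_nhdsGT hε] with x hx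
  exact hf hx.2.le

/-- Converse for one-way protocols, together with the attainment of the maximum. -/
theorem exists_infCoherentRate_output_ge [DecidableEq b]
    {ρ : ∀ n : ℕ, OpN a b n} (hρ : ∀ n, IsState (ρ n)) :
    ∃ I : ∀ n : ℕ, Instrument (Fin n → a), oneWayDistillable ρ ≤
      infCoherentRate (α := fun n => Fin (I n).dim) (β := fun n => (Fin n → b) × Fin (I n).card)
        (fun n => (I n).output (ρ n)) := by
  have hr : 0 ≤ oneWayDistillable ρ := by
    refine ge_of_tendsto (tendsto_oneWayRate ρ) ?_
    filter_upwards [self_mem_nhdsWithin] with ε hε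
    refine le_liminf_inv_mul (γ := 0) (Eventually.of_forall fun n => ?_)
    rw [mul_zero]
    exact le_iSup₂ (f := fun (R : ℝ) (_ : OneWayAchievable (ρ n) ε R) => (R : EReal)) 0
      (oneWayAchievable_zero (hρ n) (le_of_lt hε))
  obtain ⟨ε, R, hε1, hε, hR, hach⟩ := exists_achieving_seq
    (Ach := fun n ε R => OneWayAchievable (ρ n) ε R) hr
    fun ε hε => le_of_monotone_of_tendsto_nhdsGT (oneWayRate_mono ρ) (tendsto_oneWayRate ρ) hε
  have hI : ∀ n, ∃ I : Instrument (Fin n → a), OneWayAchievable (ρ n) (ε n) (R n) →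
      HasTest (I.output (ρ n)) (ε n) (R n) := by
    intro n
    by_cases hn : OneWayAchievable (ρ n) (ε n) (R n)
    · obtain ⟨I, hI⟩ := hn.exists_hasTest (hρ n) (hε1 n)
      exact ⟨I, fun _ => hI⟩
    · exact ⟨(nonempty_instrument _).some, fun h => absurd h hn⟩
  choose I hI using hI
  exact ⟨I, le_infCoherentRate (fun n => (I n).output_isState (hρ n)) hε hR
    (hach.mono fun n hn => hI n hn)⟩

/-- Converse for two-way protocols, together with the attainment of the maximum. -/
theorem exists_infCoherentRate_map_ge {ρ : ∀ n : ℕ, OpN a b n} (hρ : ∀ n, IsState (ρ n)) :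
    ∃ Λ : ∀ n : ℕ, TwoWayLOCC (Fin n → a) (Fin n → b), twoWayDistillable ρ ≤
      infCoherentRate (α := fun n => Fin (Λ n).dimA) (β := fun n => Fin (Λ n).dimB)
        (fun n => (Λ n).map (ρ n)) := by
  have hz : ∀ n (ε : ℝ), 0 ≤ ε → TwoWayAchievable (ρ n) ε 0 := fun n ε hε =>
    (oneWayAchievable_zero (hρ n) hε).twoWayAchievable
  have hr : 0 ≤ twoWayDistillable ρ := by
    refine ge_of_tendsto (tendsto_twoWayRate ρ) ?_
    filter_upwards [self_mem_nhdsWithin] with ε hε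
    refine le_liminf_inv_mul (γ := 0) (Eventually.of_forall fun n => ?_)
    rw [mul_zero]
    exact le_iSup₂ (f := fun (R : ℝ) (_ : TwoWayAchievable (ρ n) ε R) => (R : EReal)) 0
      (hz n ε (le_of_lt hε))
  obtain ⟨ε, R, hε1, hε, hR, hach⟩ := exists_achieving_seq
    (Ach := fun n ε R => TwoWayAchievable (ρ n) ε R) hr
    fun ε hε => le_of_monotone_of_tendsto_nhdsGT (twoWayRate_mono ρ) (tendsto_twoWayRate ρ) hε
  have hI : ∀ n, ∃ Λ : TwoWayLOCC (Fin n → a) (Fin n → b),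
      TwoWayAchievable (ρ n) (ε n) (R n) → HasTest (Λ.map (ρ n)) (ε n) (R n) := by
    intro n
    by_cases hn : TwoWayAchievable (ρ n) (ε n) (R n)
    · obtain ⟨I, hI⟩ := hn.exists_hasTest (hρ n) (hε1 n)
      exact ⟨I, fun _ => hI⟩
    · obtain ⟨Λ, -⟩ := (hz n 0 le_rfl).exists_hasTest (hρ n) zero_le_one
      exact ⟨Λ, fun h => absurd h hn⟩
  choose Λ hΛ using hI
  exact ⟨Λ, le_infCoherentRate (fun n => (Λ n).isState (hρ n)) hε hR
    (hach.mono fun n hn => hΛ n hn)⟩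

end Converse

end Distill

end

theorem theorem1 {a b : Type} [Fintype a] [Fintype b] [DecidableEq b]
    (ρ : ∀ n : ℕ, Distill.OpN a b n) (hρ : ∀ n, Distill.IsState (ρ n)) :
    IsGreatest
        (Set.range fun I : (∀ n : ℕ, Distill.Instrument (Fin n → a)) =>
          Distill.infCoherentRate (α := fun n => Fin (I n).dim)
            (β := fun n => (Fin n → b) × Fin (I n).card)
            (fun n => (I n).output (ρ n)))
        (Distill.oneWayDistillable ρ) ∧
      IsGreatest
        (Set.range fun Λ : (∀ n : ℕ, Distill.TwoWayLOCC (Fin n → a) (Fin n → b)) =>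
          Distill.infCoherentRate (α := fun n => Fin (Λ n).dimA)
            (β := fun n => Fin (Λ n).dimB)
            (fun n => (Λ n).map (ρ n)))
        (Distill.twoWayDistillable ρ) := by
  refine ⟨⟨?_, ?_⟩, ⟨?_, ?_⟩⟩
  · obtain ⟨I, hI⟩ := Distill.exists_infCoherentRate_output_ge hρ
    exact ⟨I, le_antisymm (Distill.infCoherentRate_output_le hρ I) hI⟩
  · rintro _ ⟨I, rfl⟩
    exact Distill.infCoherentRate_output_le hρ I
  · obtain ⟨Λ, hΛ⟩ := Distill.exists_infCoherentRate_map_ge hρ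
    exact ⟨Λ, le_antisymm (Distill.infCoherentRate_map_le hρ Λ) hΛ⟩
  · rintro _ ⟨Λ, rfl⟩
    exact Distill.infCoherentRate_map_le hρ Λ
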